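/- Let $K$ be a field, $S=K[x_1,\dots,x_n]$ (standard grading), and let $F=Se_1\oplus\cdots\oplus Se_m$ be a graded free module with $\deg(e_j)\in\mathbb N$ and $l=\max_j\deg(e_j)$. Fix a monomial order on $F$. For a submodule $N\subseteq F$ let $\mathrm{in}(N)$ be its initial module and let $\mathcal N_N$ be the set of normal forms modulo $N$, i.e. the $K$-span of the monomials of $F$ not in $\mathrm{in}(N)$. A cone is a subspace $C=C(h,u)=hK[u]\subseteq F$ with $h\ne 0$ homogeneous and $u\subseteq\{x_1,\dots,x_n\}$; put $\deg C=\deg h$ and $\dim C=|u|$. A cone decomposition of a subspace $T\subseteq F$ is a finite set $P$ of cones whose direct sum is $T$; put $\deg P=\max\{\deg C: C\in P\}$ (with $\max\emptyset=-\infty$) and $P^+=\{C\in P:\dim C>0\}$. For $q\in\mathbb N$, $P$ is $q$-standard if (1) $\deg C\ge q$ for all $C\in P^+$, and (2) for every $C\in P^+$ and every $q\le d\le\deg C$ there is $C'\in P$ with $\deg C'=d$ and $\dim C'\ge\dim C$. It is $q$-exact if moreover distinct cones of $P^+$ have distinct degrees. **Theorem 6.4.** Let $0\le r\le n$, let $g_1,\dots,g_{n-r}\in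 S$ be a regular sequence of homogeneous polynomials of degrees $d_1,\dots,d_{n-r}$, and let $f_1,\dots,f_s\in F$ be homogeneous of degrees at most $D$, where $D\ge l$. Let $M\subsetneq F$ be the submodule generated by all $g_ie_j$ ($1\le i\le n-r$, $1\le j\le m$) together with $f_1,\dots,f_s$. Let $J=(x_1^{d_1},\dots,x_{n-r}^{d_{n-r}})\subseteq S$. Then for every $l$-standard cone decomposition $Q$ of $\mathcal N_M$ and every $D$-exact cone decomposition $P$ of $\mathcal N_{JF}$, $$1+\deg Q\le\max\{\,1+\deg P^+,\ d_1+\cdots+d_{n-r}+l-n+1\,\}.$$ -/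

import Mathlib

namespace ConeDec

open MvPolynomial

/-- The monomials `x^a e_j` of the free module `F = S e_1 ⊕ ⋯ ⊕ S e_m` over
`S = K[x_1, …, x_n]`, encoded by the pair `(a, j)`. -/
abbrev Mon (n m : ℕ) : Type := (Fin n →₀ ℕ) × Fin m

/-- The free module `F = S e_1 ⊕ ⋯ ⊕ S e_m` over `S = K[x_1, …, x_n]`. -/
abbrev Free (K : Type*) [Field K] (n m : ℕ) : Type _ := Fin m → MvPolynomial (Fin n) K

/-- The monomial `x^a e_j` as an element of `F`. -/
noncomputable def mon (K : Type*) [Field K] {n m : ℕ} (u : Mon n m) : Free K n m :=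
  Pi.single u.2 (monomial u.1 1)

/-- The monomials that occur in an element of `F` with nonzero coefficient. -/
def monomials {K : Type*} [Field K] {n m : ℕ} (f : Free K n m) : Set (Mon n m) :=
  {u | coeff u.1 (f u.2) ≠ 0}

/-- A monomial order on `F`: a well-order on the monomials of `F` that is compatible with
multiplication by the monomials of `S`. -/
structure MonOrder (n m : ℕ) where
  lt : Mon n m → Mon n m → Prop
  isWellOrder : IsWellOrder (Mon n m) lt
  mul_lt : ∀ (c a b : Fin n →₀ ℕ) (i j : Fin m), lt (a, i) (b, j) → lt (c + a, i) (c + b, j)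

/-- `u` is the initial monomial of `f` (this forces `f ≠ 0`). -/
def MonOrder.IsInitial {K : Type*} [Field K] {n m : ℕ} (o : MonOrder n m)
    (f : Free K n m) (u : Mon n m) : Prop :=
  u ∈ monomials f ∧ ∀ v ∈ monomials f, v ≠ u → o.lt v u

/-- The initial module of `M`, generated over `S` by the initial monomials of the nonzero
elements of `M`. -/
noncomputable def MonOrder.initial {K : Type*} [Field K] {n m : ℕ} (o : MonOrder n m)
    (M : Submodule (MvPolynomial (Fin n) K) (Free K n m)) :
    Submodule (MvPolynomial (Fin n) K) (Free K n m) :=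
  Submodule.span _ {w | ∃ f ∈ M, ∃ u, o.IsInitial f u ∧ w = mon K u}

/-- The space `N_M` of normal forms modulo `M`: the `K`-span of the monomials of `F` that do not
lie in the initial module of `M`. -/
noncomputable def MonOrder.normalForms {K : Type*} [Field K] {n m : ℕ} (o : MonOrder n m)
    (M : Submodule (MvPolynomial (Fin n) K) (Free K n m)) : Submodule K (Free K n m) :=
  Submodule.span K {w | ∃ u : Mon n m, mon K u ∉ o.initial M ∧ w = mon K u}

theorem coeff_mon {K : Type*} [Field K] {n m : ℕ} (u v : Mon n m) :
    coeff v.1 (mon K u v.2) = if v = u then 1 else 0 := by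
  classical
  obtain ⟨a, i⟩ := u
  obtain ⟨b, j⟩ := v
  by_cases h : j = i
  · subst h
    simp [mon, coeff_monomial, eq_comm]
  · simp [mon, h]

theorem eq_sum_mon {K : Type*} [Field K] {n m : ℕ} (f : Free K n m) :
    f = ∑ j, ∑ a ∈ (f j).support, coeff a (f j) • mon K (a, j) := by
  classical
  conv_lhs => rw [← Finset.univ_sum_single f]
  refine Finset.sum_congr rfl fun j _ => ?_
  conv_lhs => rw [(f j).as_sum]
  ext k : 1
  by_cases h : k = j
  · subst h
    simp [mon, Finset.sum_apply, smul_monomial]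
  · simp [mon, Finset.sum_apply, h]

/-- `N_M` is the set of all normal forms modulo `M`, that is of all elements `r` that arise from
some `f` as a representative of `f` modulo `M` none of whose monomials lies in the initial module
of `M`. -/
theorem mem_normalForms_iff {K : Type*} [Field K] {n m : ℕ} (o : MonOrder n m)
    (M : Submodule (MvPolynomial (Fin n) K) (Free K n m)) (r : Free K n m) :
    r ∈ o.normalForms M ↔
      ∃ f : Free K n m, f - r ∈ M ∧ ∀ u ∈ monomials r, mon K u ∉ o.initial M := by
  constructor
  · intro hr
    refine ⟨r, by simp, ?_⟩
    unfold MonOrder.normalForms at hr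
    induction hr using Submodule.span_induction with
    | mem x hx =>
      obtain ⟨v, hv, rfl⟩ := hx
      intro u hu
      simp only [monomials, Set.mem_ofPred_eq, coeff_mon] at hu
      have : u = v := by by_contra h; simp [h] at hu
      exact this ▸ hv
    | zero => intro u hu; simp [monomials] at hu
    | add x y _ _ hx hy =>
      intro u hu
      by_cases h : coeff u.1 (x u.2) = 0
      · refine hy u ?_
        simpa [monomials, h] using hu
      · exact hx u h
    | smul c x _ hx =>
      intro u hu
      refine hx u ?_
      simp only [monomials, Set.mem_ofPred_eq, Pi.smul_apply, coeff_smul, smul_eq_mul] at hu ⊢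
      exact right_ne_zero_of_mul hu
  · rintro ⟨-, -, h⟩
    rw [eq_sum_mon r]
    refine Submodule.sum_mem _ fun j _ => Submodule.sum_mem _ fun a ha => ?_
    refine Submodule.smul_mem _ _ (Submodule.subset_span ⟨(a, j), h (a, j) ?_, rfl⟩)
    exact mem_support_iff.mp ha

/-- `f ∈ F` is homogeneous of degree `d`, where the basis element `e_j` has degree `e j`: each
monomial `x^a e_j` of `f` satisfies `|a| + e j = d`. -/
def IsHomog {K : Type*} [Field K] {n m : ℕ} (e : Fin m → ℕ) (f : Free K n m) (d : ℕ) : Prop :=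
  ∀ u ∈ monomials f, u.1.degree + e u.2 = d

/-- A cone `C(h, u) = h K[u]`, given by a nonzero homogeneous pivot `h` of degree `deg` and a set
`u` of variables. -/
structure Cone (K : Type*) [Field K] (n : ℕ) {m : ℕ} (e : Fin m → ℕ) where
  pivot : Free K n m
  vars : Finset (Fin n)
  deg : ℕ
  pivot_ne_zero : pivot ≠ 0
  isHomog_pivot : IsHomog e pivot deg

variable {K : Type*} [Field K] {n m : ℕ} {e : Fin m → ℕ}

/-- The dimension of a cone. -/
def Cone.dim (C : Cone K n e) : ℕ := C.vars.card

/-- The vector space `h K[u]`. -/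
noncomputable def Cone.space (C : Cone K n e) : Submodule K (Free K n m) :=
  (Subalgebra.toSubmodule (supported K (C.vars : Set (Fin n)))).map
    ((LinearMap.toSpanSingleton (MvPolynomial (Fin n) K) (Free K n m) C.pivot).restrictScalars K)

/-- `P` is a cone decomposition of `T`: the vector space `T` is the direct sum of the cones
in `P`. -/
def IsConeDecomposition (P : Finset (Cone K n e)) (T : Submodule K (Free K n m)) : Prop :=
  iSupIndep (fun C : P => C.1.space) ∧ ⨆ C : P, C.1.space = T

/-- `P⁺`: the cones of positive dimension in `P`. -/
def positiveCones (P : Finset (Cone K n e)) : Finset (Cone K n e) :=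
  P.filter fun C => 0 < C.dim

/-- The degree of a finite set of cones: the maximum of their degrees (`⊥`, meaning `-∞`, for the
empty set). -/
def degree (P : Finset (Cone K n e)) : WithBot ℤ :=
  P.sup fun C => ((C.deg : ℤ) : WithBot ℤ)

/-- `P` is a `q`-standard cone decomposition of `T`. -/
def IsStandard (q : ℕ) (P : Finset (Cone K n e)) (T : Submodule K (Free K n m)) : Prop :=
  IsConeDecomposition P T ∧
    (∀ C ∈ positiveCones P, q ≤ C.deg) ∧
    ∀ C ∈ positiveCones P, ∀ d, q ≤ d → d ≤ C.deg → ∃ C' ∈ P, C'.deg = d ∧ C.dim ≤ C'.dim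

/-- `P` is a `q`-exact cone decomposition of `T`. -/
def IsExact (q : ℕ) (P : Finset (Cone K n e)) (T : Submodule K (Free K n m)) : Prop :=
  IsStandard q P T ∧ ∀ C ∈ positiveCones P, ∀ C' ∈ positiveCones P, C ≠ C' → C.deg ≠ C'.deg

end ConeDec

/-!
The degrees of the cones in a decomposition are controlled through Hilbert series alone. A cone
`h K[u]` has the Hilbert series `X ^ deg / (1 - X) ^ dim`, so a cone decomposition `P` enters only
through its *shape*, the multiset of the pairs `(dim, deg)`, and the Hilbert series `hser` of this
shape is the Hilbert series of the decomposed space (`IsConeDecomposition.hilb_eq`).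

Let `I = (g_1, …, g_{n-r})`. Both `g_i` and `x_i ^ d_i` are regular sequences with the same degrees,
so the normal forms modulo `I F` and modulo `J F` have the same Hilbert series
`∏ (1 - X ^ d_i) ∑ X ^ e_j / (1 - X) ^ n` (`MonOrder.hilb_normalForms_of_regular`), a rational
function of degree at most `∑ d_i + l - n`. Adjoining `f_1, …, f_s` to `I F` one at a time removes
from the normal forms a space with the Hilbert series of `S / (M_{i-1} : f_i)`, translated by
`deg f_i`, where `M_{i-1} = I F + (f_1, …, f_{i-1})` (`hilb_normalForms_sup_range`). Each quotient
of `S` has the Hilbert series of a `0`-standard shape (`exists_std_countSeries`), and a `q`-standard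
shape can be made `D`-standard for `D ≥ q` by splitting cones (`Std.exists_of_le`). Hence
`hser Q + hser T = hser P` for a `D`-standard shape `T`
(`MonOrder.exists_std_hilb_sup_span`).

Make `Q` `D`-standard as well and let `A` be its sum with `T`. The shapes `A` and `P` are
`D`-standard with the same Hilbert series, and `P` is exact. Comparing the leading coefficients of
the Hilbert polynomials, one removes from both a cone of the largest dimension in degree `D`, splits
the other cones of `A` in degree `D`, and continues in degree `D + 1`; so the cones of positive
dimension in `A` have degree at most `deg P⁺` (`exists_le_of_std_of_exact`). Beyond `deg P⁺`, the
cones of dimension zero in `A` are counted by a polynomial, which is the difference of two rational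
functions of known degree, and thus is zero beyond `max (deg P⁺, ∑ d_i + l - n)`
(`coeff_eq_zero_of_hser_add`).
-/

namespace ConeDec

/-! ### Hilbert series of shapes -/

/-- The power series `1 / (1 - X) = 1 + X + X² + ⋯`. -/
noncomputable def geom : PowerSeries ℤ := PowerSeries.mk 1

theorem geom_mul : geom * (1 - PowerSeries.X) = 1 := PowerSeries.mk_one_mul_one_sub_eq_one ℤ

theorem geom_eq : geom = 1 + PowerSeries.X * geom := by
  linear_combination geom_mul

theorem one_sub_pow_mul_geom_pow {k j : ℕ} (h : j ≤ k) :
    (1 - PowerSeries.X) ^ k * geom ^ j = (1 - PowerSeries.X) ^ (k - j) := by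
  obtain ⟨i, rfl⟩ := Nat.exists_eq_add_of_le h
  rw [Nat.add_sub_cancel_left, pow_add, mul_right_comm, ← mul_pow, mul_comm _ geom, geom_mul,
    one_pow, one_mul]

theorem coeff_geom_pow_nonneg (k z : ℕ) : 0 ≤ PowerSeries.coeff z (geom ^ k) := by
  cases k with
  | zero =>
    rw [pow_zero, PowerSeries.coeff_one]
    split_ifs <;> simp
  | succ k =>
    rw [geom, PowerSeries.mk_one_pow_eq_mk_choose_add, PowerSeries.coeff_mk]
    positivity

/-- The shape of a finite set of cones `h K[u]` is the multiset of the pairs `(|u|, deg h)`;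
this is the Hilbert series `∑ X ^ deg / (1 - X) ^ dim` of the direct sum of such cones. -/
noncomputable def hser (A : Multiset (ℕ × ℕ)) : PowerSeries ℤ :=
  (A.map fun a => PowerSeries.X ^ a.2 * geom ^ a.1).sum

@[simp] theorem hser_zero : hser 0 = 0 := by simp [hser]

@[simp] theorem hser_cons (a : ℕ × ℕ) (A : Multiset (ℕ × ℕ)) :
    hser (a ::ₘ A) = PowerSeries.X ^ a.2 * geom ^ a.1 + hser A := by simp [hser]

@[simp] theorem hser_add (A B : Multiset (ℕ × ℕ)) : hser (A + B) = hser A + hser B := by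
  simp [hser]

theorem coeff_hser_nonneg (A : Multiset (ℕ × ℕ)) (z : ℕ) :
    0 ≤ PowerSeries.coeff z (hser A) := by
  induction A using Multiset.induction_on with
  | empty => simp
  | cons a A ih =>
    rw [hser_cons, map_add, PowerSeries.coeff_X_pow_mul']
    have := coeff_geom_pow_nonneg a.1 (z - a.2)
    split_ifs <;> omega

theorem coeff_hser_pos {A : Multiset (ℕ × ℕ)} {a : ℕ × ℕ} (ha : a ∈ A) :
    0 < PowerSeries.coeff a.2 (hser A) := by
  obtain ⟨B, rfl⟩ := Multiset.exists_cons_of_mem ha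
  have h := coeff_hser_nonneg B a.2
  have h1 : PowerSeries.coeff 0 (geom ^ a.1) = 1 := by
    rw [PowerSeries.coeff_zero_eq_constantCoeff_apply, map_pow]
    simp [geom, ← PowerSeries.coeff_zero_eq_constantCoeff_apply]
  rw [hser_cons, map_add, PowerSeries.coeff_X_pow_mul', if_pos le_rfl, Nat.sub_self, h1]
  omega

/-- The numerator of `hser A` over the common denominator `(1 - X) ^ k`. -/
noncomputable def numer (k : ℕ) (A : Multiset (ℕ × ℕ)) : Polynomial ℤ :=
  (A.map fun a => Polynomial.X ^ a.2 * (1 - Polynomial.X) ^ (k - a.1)).sum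

@[simp] theorem numer_zero (k : ℕ) : numer k 0 = 0 := by simp [numer]

@[simp] theorem numer_cons (k : ℕ) (a : ℕ × ℕ) (A : Multiset (ℕ × ℕ)) :
    numer k (a ::ₘ A) =
      Polynomial.X ^ a.2 * (1 - Polynomial.X) ^ (k - a.1) + numer k A := by simp [numer]

theorem coe_numer {k : ℕ} {A : Multiset (ℕ × ℕ)} (h : ∀ a ∈ A, a.1 ≤ k) :
    (numer k A : PowerSeries ℤ) = (1 - PowerSeries.X) ^ k * hser A := by
  induction A using Multiset.induction_on with
  | empty => simp
  | cons a A ih =>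
    rw [hser_cons, numer_cons, Polynomial.coe_add, ih fun b hb => h b (Multiset.mem_cons_of_mem hb),
      mul_add, mul_left_comm, one_sub_pow_mul_geom_pow (h a (Multiset.mem_cons_self a A))]
    simp

theorem one_sub_X_natDegree : (1 - Polynomial.X : Polynomial ℤ).natDegree = 1 := by
  rw [← Polynomial.natDegree_neg, neg_sub, ← Polynomial.C_1, Polynomial.natDegree_X_sub_C]

theorem natDegree_mul_one_sub_X_pow {q : Polynomial ℤ} (hq : q ≠ 0) (k : ℕ) :
    (q * (1 - Polynomial.X) ^ k).natDegree = q.natDegree + k := by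
  have h0 : (1 - Polynomial.X : Polynomial ℤ) ≠ 0 := by
    intro h
    have := one_sub_X_natDegree
    simp [h] at this
  rw [Polynomial.natDegree_mul hq (pow_ne_zero _ h0), Polynomial.natDegree_pow,
    one_sub_X_natDegree, mul_one]

theorem natDegree_numer_lt {k N : ℕ} {A : Multiset (ℕ × ℕ)} (hN : 0 < N)
    (h : ∀ a ∈ A, a.1 ≤ k ∧ a.2 + k < N + a.1) : (numer k A).natDegree < N := by
  induction A using Multiset.induction_on with
  | empty => simpa
  | cons a A ih =>
    rw [numer_cons]
    refine (Polynomial.natDegree_add_le _ _).trans_lt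
      (max_lt ?_ (ih fun b hb => h b (Multiset.mem_cons_of_mem hb)))
    rw [natDegree_mul_one_sub_X_pow (pow_ne_zero _ Polynomial.X_ne_zero), Polynomial.natDegree_X_pow]
    have := h a (Multiset.mem_cons_self a A)
    omega

/-- If a rational function with denominator `(1 - X) ^ n` differs from a Hilbert series `hser A`
by a polynomial, then the degree of that polynomial is at most the largest degree (numerator minus
denominator) of the rational functions involved. -/
theorem coeff_eq_zero_of_hser_add {A : Multiset (ℕ × ℕ)} {p q : Polynomial ℤ} {n z : ℕ}
    (h : hser A + q = p * geom ^ n) (hp : p.natDegree < z + n)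
    (hA : ∀ a ∈ A, a.2 < z + a.1) : q.coeff z = 0 := by
  by_contra hz
  obtain ⟨k, hnk, hAk⟩ : ∃ k, n ≤ k ∧ ∀ a ∈ A, a.1 ≤ k :=
    ⟨n + (A.map Prod.fst).sum, by omega, fun a ha =>
      (Multiset.le_sum_of_mem (Multiset.mem_map_of_mem _ ha)).trans (by omega)⟩
  have key : q * (1 - Polynomial.X) ^ k =
      p * (1 - Polynomial.X) ^ (k - n) - numer k A := by
    apply Polynomial.coe_injective ℤ
    simp only [Polynomial.coe_sub, Polynomial.coe_mul, Polynomial.coe_pow, Polynomial.coe_one,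
      Polynomial.coe_X, coe_numer hAk, ← one_sub_pow_mul_geom_pow hnk]
    linear_combination (1 - PowerSeries.X) ^ k * h
  have hq : q ≠ 0 := by rintro rfl; simp at hz
  have h1 := natDegree_mul_one_sub_X_pow hq k
  have h2 : z ≤ q.natDegree := Polynomial.le_natDegree_of_ne_zero hz
  have h3 : (p * (1 - Polynomial.X) ^ (k - n)).natDegree < z + k := by
    by_cases hp0 : p = 0
    · rw [hp0]; simp only [zero_mul, Polynomial.natDegree_zero]
      omega
    rw [natDegree_mul_one_sub_X_pow hp0]; omega
  have h4 : (numer k A).natDegree < z + k :=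
    natDegree_numer_lt (by omega) fun a ha => ⟨hAk a ha, by have := hA a ha; omega⟩
  have h5 := Polynomial.natDegree_sub_le (p * (1 - Polynomial.X) ^ (k - n)) (numer k A)
  rw [← key, h1] at h5
  omega

theorem eval_one_numer {k : ℕ} {A : Multiset (ℕ × ℕ)} (h : ∀ a ∈ A, a.1 ≤ k) :
    (numer k A).eval 1 = (A.filter fun a => a.1 = k).card := by
  induction A using Multiset.induction_on with
  | empty => simp
  | cons a A ih =>
    have ha := h a (Multiset.mem_cons_self a A)
    rw [numer_cons, Polynomial.eval_add, ih fun b hb => h b (Multiset.mem_cons_of_mem hb)]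
    by_cases hk : a.1 = k
    · rw [Multiset.filter_cons_of_pos (p := fun a : ℕ × ℕ => a.1 = k) _ hk]
      simp [hk, add_comm]
    · rw [Multiset.filter_cons_of_neg (p := fun a : ℕ × ℕ => a.1 = k) _ hk]
      simp [show k - a.1 ≠ 0 by omega]

/-- The number of cones of the largest dimension is the leading coefficient of the Hilbert
polynomial, up to a factor depending on the dimension only. -/
theorem card_filter_eq_of_hser_eq_add {A P : Multiset (ℕ × ℕ)} {q : Polynomial ℤ} {k : ℕ}
    (hk : 0 < k) (hA : ∀ a ∈ A, a.1 ≤ k) (hP : ∀ a ∈ P, a.1 ≤ k) (h : hser A = hser P + q) :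
    (A.filter fun a => a.1 = k).card = (P.filter fun a => a.1 = k).card := by
  have key : numer k A = numer k P + (1 - Polynomial.X) ^ k * q := by
    apply Polynomial.coe_injective ℤ
    simp only [Polynomial.coe_add, Polynomial.coe_sub, Polynomial.coe_mul, Polynomial.coe_pow,
      Polynomial.coe_one, Polynomial.coe_X, coe_numer hA, coe_numer hP]
    linear_combination (1 - PowerSeries.X) ^ k * h
  have := congrArg (Polynomial.eval 1) key
  rw [Polynomial.eval_add, eval_one_numer hA, eval_one_numer hP] at this
  simpa [hk.ne'] using this

/-! ### Standard shapes -/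

/-- The shape `A` is that of a `q`-standard set of cones. -/
def Std (q : ℕ) (A : Multiset (ℕ × ℕ)) : Prop :=
  ∀ a ∈ A, 0 < a.1 → q ≤ a.2 ∧ ∀ t, q ≤ t → t ≤ a.2 → ∃ b ∈ A, b.2 = t ∧ a.1 ≤ b.1

theorem Std.add {q : ℕ} {A B : Multiset (ℕ × ℕ)} (hA : Std q A) (hB : Std q B) :
    Std q (A + B) := by
  intro a ha hpos
  rcases Multiset.mem_add.1 ha with ha | ha
  · refine ⟨(hA a ha hpos).1, fun t h1 h2 => ?_⟩
    obtain ⟨b, hb, h⟩ := (hA a ha hpos).2 t h1 h2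
    exact ⟨b, Multiset.mem_add.2 (Or.inl hb), h⟩
  · refine ⟨(hB a ha hpos).1, fun t h1 h2 => ?_⟩
    obtain ⟨b, hb, h⟩ := (hB a ha hpos).2 t h1 h2
    exact ⟨b, Multiset.mem_add.2 (Or.inr hb), h⟩

theorem Std.filter_pos {q : ℕ} {A : Multiset (ℕ × ℕ)} (hA : Std q A) :
    Std q (A.filter fun a => 0 < a.1) := by
  intro a ha hpos
  rw [Multiset.mem_filter] at ha
  refine ⟨(hA a ha.1 hpos).1, fun t h1 h2 => ?_⟩
  obtain ⟨b, hb, h⟩ := (hA a ha.1 hpos).2 t h1 h2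
  exact ⟨b, Multiset.mem_filter.2 ⟨hb, by omega⟩, h⟩

theorem exists_polynomial_filter_pos (A : Multiset (ℕ × ℕ)) :
    ∃ q : Polynomial ℤ, hser A = hser (A.filter fun a => 0 < a.1) + q ∧
      hser (A.filter fun a => ¬ 0 < a.1) = q := by
  have h0 : ∃ q : Polynomial ℤ, hser (A.filter fun a => ¬ 0 < a.1) = q := by
    induction A using Multiset.induction_on with
    | empty => exact ⟨0, by simp⟩
    | cons a A ih =>
      obtain ⟨q, hq⟩ := ih
      by_cases ha : 0 < a.1
      · exact ⟨q, by rw [Multiset.filter_cons_of_neg (p := fun a : ℕ × ℕ => ¬ 0 < a.1) _ (not_not.2 ha), hq]⟩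
      · refine ⟨Polynomial.X ^ a.2 + q, ?_⟩
        rw [Multiset.filter_cons_of_pos (p := fun a : ℕ × ℕ => ¬ 0 < a.1) _ ha, hser_cons, hq, show a.1 = 0 by omega]
        simp
  obtain ⟨q, hq⟩ := h0
  refine ⟨q, ?_, hq⟩
  rw [← hq, ← hser_add, Multiset.filter_add_not]

/-- The shape of the decomposition of a cone `h K[x_1, …, x_k]` into `h K` and the cones
`h x_i K[x_1, …, x_i]`. -/
def splitCone (a : ℕ × ℕ) : Multiset (ℕ × ℕ) :=
  (0, a.2) ::ₘ (Multiset.range a.1).map fun i => (i + 1, a.2 + 1)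

theorem hser_splitCone (a : ℕ × ℕ) : hser (splitCone a) = PowerSeries.X ^ a.2 * geom ^ a.1 := by
  obtain ⟨k, D⟩ := a
  induction k with
  | zero => simp [splitCone, hser]
  | succ k ih =>
    simp only [splitCone, hser_cons] at ih ⊢
    rw [Multiset.range_succ, Multiset.map_cons, hser_cons]
    have h := geom_eq
    linear_combination ih - PowerSeries.X ^ D * geom ^ k * h

/-- Splitting all cones of positive dimension in degree `q` makes a shape `(q+1)`-standard. -/
theorem exists_std_succ {q : ℕ} {A : Multiset (ℕ × ℕ)}
    (hA : ∀ a ∈ A, 0 < a.1 → q ≤ a.2 ∧ ∀ t, q + 1 ≤ t → t ≤ a.2 → ∃ b ∈ A, b.2 = t ∧ a.1 ≤ b.1) :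
    ∃ A', Std (q + 1) A' ∧ hser A' = hser A ∧ ∀ a ∈ A, q + 1 ≤ a.2 → a ∈ A' := by
  set R := A.filter fun a => 0 < a.1 ∧ a.2 = q with hR
  set B := A.filter fun a => ¬ (0 < a.1 ∧ a.2 = q) with hB
  have hkeep : ∀ a ∈ A, q + 1 ≤ a.2 → a ∈ B := fun a ha h =>
    Multiset.mem_filter.2 ⟨ha, by omega⟩
  refine ⟨B + R.bind splitCone, ?_, ?_, fun a ha h => Multiset.mem_add.2 (Or.inl (hkeep a ha h))⟩
  · intro a ha hpos
    rcases Multiset.mem_add.1 ha with ha | ha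
    · obtain ⟨ha, hq⟩ := Multiset.mem_filter.1 ha
      have h1 := (hA a ha hpos).1
      refine ⟨by omega, fun t ht hta => ?_⟩
      obtain ⟨b, hb, hbt, hab⟩ := (hA a ha hpos).2 t ht hta
      exact ⟨b, Multiset.mem_add.2 (Or.inl (hkeep b hb (by omega))), hbt, hab⟩
    · have ha' := ha
      obtain ⟨c, hc, hac⟩ := Multiset.mem_bind.1 ha
      obtain ⟨-, -, hcq⟩ := Multiset.mem_filter.1 hc
      have h2 : a.2 = q + 1 := by
        rcases Multiset.mem_cons.1 hac with rfl | h
        · simp at hpos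
        · obtain ⟨i, -, rfl⟩ := Multiset.mem_map.1 h
          simp [hcq]
      refine ⟨h2.ge, fun t ht hta => ⟨a, Multiset.mem_add.2 (Or.inr ha'), by omega, le_rfl⟩⟩
  · have h : ∀ C : Multiset (ℕ × ℕ), hser (C.bind splitCone) = hser C := by
      intro C
      induction C using Multiset.induction_on with
      | empty => simp
      | cons a C ih => rw [Multiset.cons_bind, hser_add, hser_splitCone, ih, hser_cons]
    rw [hser_add, h, add_comm, ← hser_add, Multiset.filter_add_not]

theorem Std.exists_of_le {q D : ℕ} (hqD : q ≤ D) {A : Multiset (ℕ × ℕ)} (hA : Std q A) :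
    ∃ A', Std D A' ∧ hser A' = hser A ∧ ∀ a ∈ A, D ≤ a.2 → a ∈ A' := by
  induction D, hqD using Nat.le_induction with
  | base => exact ⟨A, hA, rfl, fun a ha _ => ha⟩
  | succ D hD ih =>
    obtain ⟨B, hB, hBA, hmem⟩ := ih
    obtain ⟨C, hC, hCB, hmem'⟩ := exists_std_succ (q := D) (A := B) fun a ha hpos =>
      ⟨(hB a ha hpos).1, fun t ht => (hB a ha hpos).2 t (by omega)⟩
    exact ⟨C, hC, hCB.trans hBA, fun a ha h => hmem' a (hmem a ha (by omega)) h⟩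

/-- Among the standard shapes with a given Hilbert polynomial, an exact one reaches the highest
degree in positive dimension. -/
theorem exists_le_of_std_of_exact (P : Multiset (ℕ × ℕ)) : ∀ (D : ℕ) (A : Multiset (ℕ × ℕ)),
    (∀ p ∈ P, 0 < p.1) → (∀ a ∈ A, 0 < a.1) → Std D A → Std D P → (P.map Prod.snd).Nodup →
    (∃ q : Polynomial ℤ, hser A = hser P + q) → ∀ a ∈ A, ∃ p ∈ P, a.2 ≤ p.2 := by
  induction hcard : P.card using Nat.strong_induction_on generalizing P with
  | _ N ih =>
  subst hcard
  intro D A hPpos hApos hA hP hnd ⟨q, hq⟩ a ha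
  -- the largest dimension `k` occurring in `A` or `P` occurs in both of them
  obtain ⟨c, hc, hmax⟩ := (A + P).toFinset.exists_max_image Prod.fst
    ⟨a, by simp [ha]⟩
  simp only [Multiset.mem_toFinset, Multiset.mem_add] at hc hmax
  have hcpos : 0 < c.1 := hc.elim (hApos c) (hPpos c)
  have hcnt := card_filter_eq_of_hser_eq_add hcpos (fun b hb => hmax b (Or.inl hb))
    (fun b hb => hmax b (Or.inr hb)) hq
  have hex : (∃ b ∈ A, b.1 = c.1) ∧ ∃ b ∈ P, b.1 = c.1 := by
    have hA' : 0 < (A.filter fun b => b.1 = c.1).card ↔ ∃ b ∈ A, b.1 = c.1 := by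
      rw [Multiset.card_pos_iff_exists_mem]; simp
    have hP' : 0 < (P.filter fun b => b.1 = c.1).card ↔ ∃ b ∈ P, b.1 = c.1 := by
      rw [Multiset.card_pos_iff_exists_mem]; simp
    rw [← hA', ← hP', ← hcnt, and_self, hA']
    rcases hc with hc | hc
    · exact ⟨c, hc, rfl⟩
    · rw [← hA', hcnt, hP']; exact ⟨c, hc, rfl⟩
  -- by standardness it occurs in degree `D`
  have hbot : ∀ B : Multiset (ℕ × ℕ), Std D B → (∀ b ∈ B, b.1 ≤ c.1) → (∃ b ∈ B, b.1 = c.1) →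
      (c.1, D) ∈ B := by
    rintro B hB hle ⟨b, hb, hbc⟩
    obtain ⟨h1, h2⟩ := hB b hb (by omega)
    obtain ⟨b', hb', rfl, h3⟩ := h2 D le_rfl h1
    have := hle b' hb'
    rwa [show c.1 = b'.1 by omega]
  obtain ⟨A', rfl⟩ := Multiset.exists_cons_of_mem
    (hbot A hA (fun b hb => hmax b (Or.inl hb)) hex.1)
  obtain ⟨P', rfl⟩ := Multiset.exists_cons_of_mem
    (hbot P hP (fun b hb => hmax b (Or.inr hb)) hex.2)
  rw [Multiset.map_cons, Multiset.nodup_cons] at hnd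
  -- remove it on both sides and make the rest of `A` standard in degree `D + 1`
  obtain ⟨A'', hstd, hser', hmem⟩ := exists_std_succ (q := D) (A := A') fun b hb hpos => by
    obtain ⟨h1, h2⟩ := hA b (Multiset.mem_cons_of_mem hb) hpos
    refine ⟨h1, fun t ht htb => ?_⟩
    obtain ⟨b', hb', hbt, hle⟩ := h2 t (by omega) htb
    rcases Multiset.mem_cons.1 hb' with rfl | hb'
    · simp at hbt; omega
    · exact ⟨b', hb', hbt, hle⟩
  have hPstd : Std (D + 1) P' := fun p hp hpos => by
    obtain ⟨h1, h2⟩ := hP p (Multiset.mem_cons_of_mem hp) hpos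
    have hne : p.2 ≠ D := fun h => hnd.1 (Multiset.mem_map.2 ⟨p, hp, h⟩)
    refine ⟨by omega, fun t ht htb => ?_⟩
    obtain ⟨b', hb', hbt, hle⟩ := h2 t (by omega) htb
    rcases Multiset.mem_cons.1 hb' with rfl | hb'
    · simp at hbt; omega
    · exact ⟨b', hb', hbt, hle⟩
  obtain ⟨q', hq', -⟩ := exists_polynomial_filter_pos A''
  by_cases haD : a.2 ≤ D
  · exact ⟨_, Multiset.mem_cons_self _ _, haD⟩
  have haA' : a ∈ A' := by
    rcases Multiset.mem_cons.1 ha with rfl | ha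
    · simp at haD
    · exact ha
  obtain ⟨p, hp, hap⟩ := ih P'.card (by simp) P' rfl (D + 1) (A''.filter fun a => 0 < a.1)
    (fun p hp => hPpos p (Multiset.mem_cons_of_mem hp)) (fun b hb => (Multiset.mem_filter.1 hb).2)
    hstd.filter_pos hPstd hnd.2
    ⟨q - q', by
      rw [hser_cons, hser_cons] at hq
      rw [Polynomial.coe_sub]
      linear_combination hq + hser' - hq'⟩ a
    (Multiset.mem_filter.2 ⟨hmem a haA' (by omega), hApos a ha⟩)
  exact ⟨p, Multiset.mem_cons_of_mem hp, hap⟩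

/-- The degree bound for shapes. Both the degrees of `P` in positive dimension and the degree of
the rational function `p / (1 - X) ^ n` bound the degrees of `Q`. -/
theorem degree_bound {Q T P : Multiset (ℕ × ℕ)} {l D n z : ℕ} (hlD : l ≤ D) (hQ : Std l Q)
    (hT : Std D T) (hP : Std D P)
    (hnd : ((P.filter fun a => 0 < a.1).map Prod.snd).Nodup)
    (hser_eq : hser Q + hser T = hser P) {p : Polynomial ℤ} (hp : hser P = p * geom ^ n)
    (hz : p.natDegree < z + n) (hzP : ∀ a ∈ P, 0 < a.1 → a.2 < z) : ∀ a ∈ Q, a.2 ≠ z := by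
  rintro a ha rfl
  by_cases hPe : ∃ b ∈ P, 0 < b.1
  · -- the degree in question is at least `D`, so it survives in a `D`-standard shape
    obtain ⟨b, hb, hbpos⟩ := hPe
    have hDa : D ≤ a.2 := ((hP b hb hbpos).1.trans_lt (hzP b hb hbpos)).le
    obtain ⟨Q', hQ', hQser, hQmem⟩ := hQ.exists_of_le hlD
    set A := Q' + T with hA
    have hAP : hser A = hser P := by rw [hA, hser_add, hQser, hser_eq]
    have haA : a ∈ A := Multiset.mem_add.2 (Or.inl (hQmem a ha hDa))
    obtain ⟨qA, hqA, hqA'⟩ := exists_polynomial_filter_pos A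
    obtain ⟨qP, hqP, -⟩ := exists_polynomial_filter_pos P
    have htop := exists_le_of_std_of_exact (P.filter fun a => 0 < a.1) D
      (A.filter fun a => 0 < a.1) (fun p hp => (Multiset.mem_filter.1 hp).2)
      (fun p hp => (Multiset.mem_filter.1 hp).2) (hQ'.add hT).filter_pos hP.filter_pos hnd
      ⟨qP - qA, by rw [Polynomial.coe_sub]; linear_combination hAP + hqP - hqA⟩
    have hlt : ∀ c ∈ A.filter fun a => 0 < a.1, c.2 < a.2 := fun c hc => by
      obtain ⟨b', hb', hle⟩ := htop c hc
      rw [Multiset.mem_filter] at hb'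
      exact hle.trans_lt (hzP b' hb'.1 hb'.2)
    have h0 : qA.coeff a.2 = 0 := coeff_eq_zero_of_hser_add (A := A.filter fun a => 0 < a.1)
      (by rw [← hqA, hAP, hp]) hz fun c hc => (hlt c hc).trans_le (Nat.le_add_right _ _)
    have hpos : 0 < PowerSeries.coeff a.2 (hser (A.filter fun a => ¬ 0 < a.1)) :=
      coeff_hser_pos (Multiset.mem_filter.2
        ⟨haA, fun h => (hlt a (Multiset.mem_filter.2 ⟨haA, h⟩)).false⟩)
    rw [hqA', Polynomial.coeff_coe, h0] at hpos
    exact hpos.false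
  · -- the Hilbert series is a polynomial
    push Not at hPe
    obtain ⟨q, hq, -⟩ := exists_polynomial_filter_pos P
    rw [Multiset.filter_eq_nil.2 fun b hb => (hPe b hb).not_gt, hser_zero, zero_add] at hq
    have h0 : q.coeff a.2 = 0 :=
      coeff_eq_zero_of_hser_add (A := 0) (by rw [hser_zero, zero_add, ← hq, hp]) hz (by simp)
    have h1 := coeff_hser_pos ha
    have h2 := coeff_hser_nonneg T a.2
    have h3 := congrArg (PowerSeries.coeff a.2) (hser_eq.trans hq)
    rw [map_add, Polynomial.coeff_coe, h0] at h3
    omega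

open MvPolynomial

variable {K : Type*} [Field K] {n m : ℕ} {e : Fin m → ℕ}

/-! ### Monomials and graded pieces of the free module -/

theorem free_ext {f g : Free K n m} (h : ∀ u : Mon n m, coeff u.1 (f u.2) = coeff u.1 (g u.2)) :
    f = g := by
  funext j
  ext a
  exact h (a, j)

theorem mem_monomials_mon {u v : Mon n m} : v ∈ monomials (mon K u) ↔ v = u := by
  simp [monomials, coeff_mon]

theorem span_range_mon : Submodule.span K (Set.range (mon K (n := n) (m := m))) = ⊤ := by
  rw [eq_top_iff]
  intro f _
  rw [eq_sum_mon f]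
  exact Submodule.sum_mem _ fun j _ => Submodule.sum_mem _ fun a _ =>
    Submodule.smul_mem _ _ (Submodule.subset_span ⟨_, rfl⟩)

theorem linearMap_ext_mon {V : Type*} [AddCommGroup V] [Module K V] {φ ψ : Free K n m →ₗ[K] V}
    (h : ∀ u, φ (mon K u) = ψ (mon K u)) : φ = ψ :=
  LinearMap.ext_on_range span_range_mon h

/-- An element lies in the span of a set of monomials if its monomials belong to that set. -/
theorem mem_span_mon {B : Set (Mon n m)} {f : Free K n m} (h : monomials f ⊆ B) :
    f ∈ Submodule.span K (mon K '' B) := by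
  rw [eq_sum_mon f]
  refine Submodule.sum_mem _ fun j _ => Submodule.sum_mem _ fun a ha =>
    Submodule.smul_mem _ _ (Submodule.subset_span ⟨(a, j), h (mem_support_iff.1 ha), rfl⟩)

theorem monomials_add_subset (f g : Free K n m) :
    monomials (f + g) ⊆ monomials f ∪ monomials g := by
  intro u hu
  by_contra h
  simp only [monomials, Set.mem_union, Set.mem_ofPred_eq, not_or, not_not] at h
  exact hu (by simp [h.1, h.2])

/-- The monomials of a product `p f`. -/
theorem exists_of_mem_monomials_smul {p : MvPolynomial (Fin n) K} {f : Free K n m} {u : Mon n m}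
    (hu : u ∈ monomials (p • f)) :
    ∃ c a, coeff c p ≠ 0 ∧ (a, u.2) ∈ monomials f ∧ c + a = u.1 := by
  classical
  simp only [monomials, Set.mem_ofPred_eq, Pi.smul_apply, smul_eq_mul, coeff_mul] at hu
  obtain ⟨⟨c, a⟩, hmem, hne⟩ := Finset.exists_ne_zero_of_sum_ne_zero hu
  exact ⟨c, a, left_ne_zero_of_mul hne, right_ne_zero_of_mul hne, Finset.HasAntidiagonal.mem_antidiagonal.1 hmem⟩

theorem isHomog_mon (e : Fin m → ℕ) (u : Mon n m) :
    IsHomog e (mon K u) (u.1.degree + e u.2) := by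
  intro v hv
  rw [mem_monomials_mon.1 hv]

theorem IsHomog.smul {p : MvPolynomial (Fin n) K} {f : Free K n m} {i d : ℕ}
    (hp : p.IsHomogeneous i) (hf : IsHomog e f d) : IsHomog e (p • f) (i + d) := by
  intro u hu
  obtain ⟨c, a, hc, ha, hca⟩ := exists_of_mem_monomials_smul hu
  have h1 : c.degree = i := by
    rw [Finsupp.degree_eq_weight_one]
    exact hp hc
  have h2 := hf _ ha
  rw [← hca, map_add, h1]
  simp only at h2
  omega

/-- The projection of the free module onto its component of degree `z`. -/
noncomputable def gr (e : Fin m → ℕ) (z : ℕ) : Free K n m →ₗ[K] Free K n m :=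
  LinearMap.pi fun j =>
    if e j ≤ z then homogeneousComponent (z - e j) ∘ₗ LinearMap.proj j else 0

theorem coeff_gr (e : Fin m → ℕ) (z : ℕ) (f : Free K n m) (u : Mon n m) :
    coeff u.1 (gr e z f u.2) = if u.1.degree + e u.2 = z then coeff u.1 (f u.2) else 0 := by
  rw [gr, LinearMap.pi_apply]
  by_cases h : e u.2 ≤ z
  · rw [if_pos h, LinearMap.comp_apply, coeff_homogeneousComponent]
    simp only [LinearMap.proj_apply]
    congr 1
    exact propext (by omega)
  · rw [if_neg h, if_neg (by omega)]
    simp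

theorem gr_of_isHomog {f : Free K n m} {d : ℕ} (hf : IsHomog e f d) (z : ℕ) :
    gr e z f = if d = z then f else 0 := by
  refine free_ext fun u => ?_
  rw [coeff_gr]
  by_cases hu : u ∈ monomials f
  · rw [hf u hu]
    split_ifs <;> simp
  · rw [monomials, Set.mem_ofPred_eq, not_not] at hu
    split_ifs <;> simp [hu]

theorem isHomog_gr (e : Fin m → ℕ) (z : ℕ) (f : Free K n m) : IsHomog e (gr e z f) z := by
  intro u hu
  rw [monomials, Set.mem_ofPred_eq, coeff_gr] at hu
  by_contra h
  simp [h] at hu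

theorem finite_mon_degree (e : Fin m → ℕ) (z : ℕ) :
    {u : Mon n m | u.1.degree + e u.2 = z}.Finite := by
  refine Set.Finite.subset ((Finsupp.finite_of_degree_le (σ := Fin n) z).prod
    (Set.finite_univ (α := Fin m))) fun u hu => ⟨?_, trivial⟩
  simp only [Set.mem_ofPred_eq] at hu ⊢
  omega

instance finiteDimensional_map_gr (V : Submodule K (Free K n m)) (z : ℕ) :
    FiniteDimensional K (V.map (gr e z)) := by
  have := FiniteDimensional.span_of_finite K ((finite_mon_degree (n := n) e z).image (mon K))
  refine Submodule.finiteDimensional_of_le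
    (S₂ := Submodule.span K (mon K '' {u : Mon n m | u.1.degree + e u.2 = z})) ?_
  rintro _ ⟨f, -, rfl⟩
  exact mem_span_mon fun u hu => isHomog_gr e z f u hu

/-- A subspace of the free module is graded if it contains the homogeneous components of its
elements. -/
def IsGraded (e : Fin m → ℕ) (V : Submodule K (Free K n m)) : Prop :=
  ∀ z, V.map (gr e z) ≤ V

theorem IsGraded.iSup {ι : Sort*} {V : ι → Submodule K (Free K n m)} (h : ∀ i, IsGraded e (V i)) :
    IsGraded e (⨆ i, V i) := by
  intro z
  rw [Submodule.map_iSup]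
  exact iSup_mono fun i => h i z

theorem isGraded_bot : IsGraded e (⊥ : Submodule K (Free K n m)) := by
  intro z
  simp

theorem isGraded_span_mon (e : Fin m → ℕ) (B : Set (Mon n m)) :
    IsGraded e (Submodule.span K (mon K '' B)) := by
  intro z
  rw [Submodule.map_span_le]
  rintro _ ⟨u, hu, rfl⟩
  rw [gr_of_isHomog (isHomog_mon e u)]
  split_ifs
  · exact Submodule.subset_span ⟨u, hu, rfl⟩
  · exact zero_mem _

/-! ### Hilbert series of graded subspaces -/

/-- The Hilbert series of a graded subspace: for graded `V`, the image of `V` under the projection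
to degree `z` is the component of `V` in that degree. -/
noncomputable def hilb (e : Fin m → ℕ) (V : Submodule K (Free K n m)) : PowerSeries ℤ :=
  PowerSeries.mk fun z => (Module.finrank K (V.map (gr e z)) : ℤ)

theorem hilb_bot (e : Fin m → ℕ) : hilb e (⊥ : Submodule K (Free K n m)) = 0 := by
  ext z
  simp [hilb]

theorem hilb_sup {V W : Submodule K (Free K n m)} (hV : IsGraded e V) (hW : IsGraded e W)
    (h : Disjoint V W) : hilb e (V ⊔ W) = hilb e V + hilb e W := by
  ext z
  simp only [hilb, PowerSeries.coeff_mk, map_add]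
  rw [Submodule.map_sup]
  have := Submodule.finrank_sup_add_finrank_inf_eq (V.map (gr e z)) (W.map (gr e z))
  rw [(h.mono (hV z) (hW z)).eq_bot, finrank_bot, add_zero] at this
  exact_mod_cast this

theorem hilb_finset_sup {ι : Type*} (s : Finset ι) (V : ι → Submodule K (Free K n m))
    (hV : ∀ i, IsGraded e (V i)) (h : s.SupIndep V) :
    hilb e (s.sup V) = ∑ i ∈ s, hilb e (V i) := by
  classical
  induction s using Finset.induction_on with
  | empty => simp [hilb_bot]
  | insert a s ha ih =>
    have h1 : Disjoint (V a) (s.sup V) :=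
      h (Finset.subset_insert a s) (Finset.mem_insert_self a s) ha
    have h2 : IsGraded e (s.sup V) := by
      rw [Finset.sup_eq_iSup]
      exact IsGraded.iSup fun i => IsGraded.iSup fun _ => hV i
    rw [Finset.sup_insert, Finset.sum_insert ha, hilb_sup (hV a) h2 h1,
      ih (Finset.SupIndep.subset h (Finset.subset_insert a s))]

/-- A linear map of degree `δ` between graded free modules. -/
def IsGradedMap {m' : ℕ} (e : Fin m → ℕ) (e' : Fin m' → ℕ) (δ : ℕ)
    (φ : Free K n m →ₗ[K] Free K n m') : Prop :=
  ∀ z f, gr e' z (φ f) = if δ ≤ z then φ (gr e (z - δ) f) else 0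

theorem isGradedMap_of_mon {m' : ℕ} {e' : Fin m' → ℕ} {δ : ℕ} {φ : Free K n m →ₗ[K] Free K n m'}
    (h : ∀ u : Mon n m, IsHomog e' (φ (mon K u)) (u.1.degree + e u.2 + δ)) :
    IsGradedMap e e' δ φ := by
  intro z f
  by_cases hz : δ ≤ z
  · rw [if_pos hz]
    suffices H : gr e' z ∘ₗ φ = φ ∘ₗ gr e (z - δ) from LinearMap.congr_fun H f
    refine linearMap_ext_mon fun u => ?_
    rw [LinearMap.comp_apply, LinearMap.comp_apply, gr_of_isHomog (h u),
      gr_of_isHomog (isHomog_mon e u), apply_ite φ, map_zero]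
    congr 1
    exact propext (by omega)
  · rw [if_neg hz]
    suffices H : gr e' z ∘ₗ φ = 0 from LinearMap.congr_fun H f
    refine linearMap_ext_mon fun u => ?_
    rw [LinearMap.comp_apply, gr_of_isHomog (h u), if_neg (by omega), LinearMap.zero_apply]

theorem IsGradedMap.isGraded_map {m' : ℕ} {e' : Fin m' → ℕ} {δ : ℕ}
    {φ : Free K n m →ₗ[K] Free K n m'} (h : IsGradedMap e e' δ φ)
    {V : Submodule K (Free K n m)} (hV : IsGraded e V) : IsGraded e' (V.map φ) := by
  rintro z _ ⟨_, ⟨f, hf, rfl⟩, rfl⟩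
  rw [h z f]
  split_ifs
  · exact Submodule.mem_map_of_mem (hV _ (Submodule.mem_map_of_mem hf))
  · exact zero_mem _

/-- The Hilbert series of the image under a map of degree `δ` that is injective on `V`. -/
theorem IsGradedMap.hilb_map {m' : ℕ} {e' : Fin m' → ℕ} {δ : ℕ}
    {φ : Free K n m →ₗ[K] Free K n m'} (h : IsGradedMap e e' δ φ)
    {V : Submodule K (Free K n m)} (hV : IsGraded e V) (hφ : ∀ f ∈ V, φ f = 0 → f = 0) :
    hilb e' (V.map φ) = PowerSeries.X ^ δ * hilb e V := by
  ext z
  rw [PowerSeries.coeff_X_pow_mul', hilb, hilb, PowerSeries.coeff_mk]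
  split_ifs with hz
  · rw [PowerSeries.coeff_mk]
    have h1 : (V.map φ).map (gr e' z) = (V.map (gr e (z - δ))).map φ := by
      rw [← Submodule.map_comp, ← Submodule.map_comp]
      congr 1
      refine LinearMap.ext fun f => ?_
      exact (h z f).trans (if_pos hz)
    have h2 : Function.Injective (φ.domRestrict (V.map (gr e (z - δ)))) := by
      rw [injective_iff_map_eq_zero]
      rintro ⟨f, hf⟩ h0
      exact Subtype.ext (hφ f (hV _ hf) h0)
    rw [h1, ← LinearMap.range_domRestrict, LinearMap.finrank_range_of_inj h2]
  · have h1 : (V.map φ).map (gr e' z) = ⊥ := by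
      rw [eq_bot_iff]
      rintro _ ⟨_, ⟨f, -, rfl⟩, rfl⟩
      exact (h z f).trans (if_neg hz)
    rw [h1, finrank_bot, Nat.cast_zero]

/-! ### Counting monomials -/

/-- The generating series of the numbers of elements of each degree in a set of exponents. -/
noncomputable def countSeries (B : Set (Fin n →₀ ℕ)) : PowerSeries ℤ :=
  PowerSeries.mk fun z => (Set.ncard {a | a ∈ B ∧ a.degree = z} : ℤ)

/-- Sorting exponents by whether the variable `x` divides the monomial. -/
theorem countSeries_split (B : Set (Fin n →₀ ℕ)) (x : Fin n) :
    countSeries B = countSeries {a | a ∈ B ∧ a x = 0} +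
      PowerSeries.X * countSeries {a | a + Finsupp.single x 1 ∈ B} := by
  classical
  have hfin : ∀ (C : Set (Fin n →₀ ℕ)) z, {a | a ∈ C ∧ a.degree = z}.Finite := fun C z =>
    (Finsupp.finite_of_degree_eq z).subset fun a ha => ha.2
  ext z
  rw [map_add, ← pow_one PowerSeries.X, PowerSeries.coeff_X_pow_mul']
  simp only [countSeries, PowerSeries.coeff_mk]
  have hinj : Function.Injective fun a : Fin n →₀ ℕ => a + Finsupp.single x 1 :=
    add_left_injective _
  have hunion : {a | a ∈ B ∧ a.degree = z} = {a | a ∈ {a | a ∈ B ∧ a x = 0} ∧ a.degree = z} ∪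
      (fun a => a + Finsupp.single x 1) ''
        {a | a + Finsupp.single x 1 ∈ B ∧ a.degree + 1 = z} := by
    ext a
    simp only [Set.mem_ofPred_eq, Set.mem_union, Set.mem_image]
    constructor
    · rintro ⟨haB, haz⟩
      by_cases hx : a x = 0
      · exact Or.inl ⟨⟨haB, hx⟩, haz⟩
      · have h : a - Finsupp.single x 1 + Finsupp.single x 1 = a :=
          tsub_add_cancel_of_le (by simpa [Nat.one_le_iff_ne_zero] using hx)
        refine Or.inr ⟨a - Finsupp.single x 1, ⟨by rwa [h], ?_⟩, h⟩
        rw [← haz, ← congrArg Finsupp.degree h, map_add, Finsupp.degree_single]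
    · rintro (⟨⟨haB, -⟩, haz⟩ | ⟨b, ⟨hb, hbz⟩, rfl⟩)
      · exact ⟨haB, haz⟩
      · exact ⟨hb, by rw [map_add, Finsupp.degree_single, hbz]⟩
  have hdisj : Disjoint {a | a ∈ {a | a ∈ B ∧ a x = 0} ∧ a.degree = z}
      ((fun a => a + Finsupp.single x 1) ''
        {a | a + Finsupp.single x 1 ∈ B ∧ a.degree + 1 = z}) := by
    rw [Set.disjoint_left]
    rintro _ ⟨⟨-, h0⟩, -⟩ ⟨b, -, rfl⟩
    simp at h0
  have hfin' : {a | a + Finsupp.single x 1 ∈ B ∧ a.degree + 1 = z}.Finite :=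
    (Finsupp.finite_of_degree_le z).subset fun a ha => by
      have := ha.2
      simp only [Set.mem_ofPred_eq]
      omega
  rw [hunion, Set.ncard_union_eq hdisj (hfin _ z) (hfin'.image _),
    Set.ncard_image_of_injective _ hinj, Nat.cast_add]
  congr 1
  split_ifs with hz
  · congr 3
    ext a
    simp only [Set.mem_ofPred_eq]
    exact and_congr_right fun _ => by omega
  · rw [Nat.cast_eq_zero, Set.ncard_eq_zero hfin', Set.eq_empty_iff_forall_notMem]
    rintro a ⟨-, ha⟩
    omega

theorem countSeries_empty : countSeries (∅ : Set (Fin n →₀ ℕ)) = 0 := by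
  ext z
  simp [countSeries]

/-- The Hilbert series of a polynomial ring in `|u|` variables. -/
theorem countSeries_support_subset (u : Finset (Fin n)) :
    countSeries {a : Fin n →₀ ℕ | a.support ⊆ u} = geom ^ u.card := by
  classical
  induction u using Finset.induction_on with
  | empty =>
    ext z
    rw [countSeries, PowerSeries.coeff_mk, Finset.card_empty, pow_zero, PowerSeries.coeff_one]
    by_cases hz : z = 0
    · rw [if_pos hz, show {a | a ∈ {a : Fin n →₀ ℕ | a.support ⊆ ∅} ∧ a.degree = z} = {0} by
        ext a
        simp only [Set.mem_ofPred_eq, Finset.subset_empty, Finsupp.support_eq_empty,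
          Set.mem_singleton_iff]
        exact ⟨fun h => h.1, fun h => ⟨h, by rw [h, hz, map_zero]⟩⟩]
      simp
    · rw [if_neg hz, Nat.cast_eq_zero]
      convert Set.ncard_empty (Fin n →₀ ℕ)
      rw [Set.eq_empty_iff_forall_notMem]
      rintro a ⟨ha, haz⟩
      simp only [Set.mem_ofPred_eq, Finset.subset_empty, Finsupp.support_eq_empty] at ha
      rw [ha, map_zero] at haz
      exact hz haz.symm
  | insert x u hx ih =>
    have h := countSeries_split {a : Fin n →₀ ℕ | a.support ⊆ insert x u} x
    have h1 : {a | a ∈ {a : Fin n →₀ ℕ | a.support ⊆ insert x u} ∧ a x = 0} =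
        {a | a.support ⊆ u} := by
      ext a
      simp only [Set.mem_ofPred_eq]
      constructor
      · rintro ⟨h1, h2⟩
        exact (Finset.subset_insert_iff_of_notMem (by simpa using h2)).1 h1
      · intro h1
        exact ⟨h1.trans (Finset.subset_insert x u),
          Finsupp.notMem_support_iff.1 fun h => hx (h1 h)⟩
    have h2 : {a | a + Finsupp.single x 1 ∈ {a : Fin n →₀ ℕ | a.support ⊆ insert x u}} =
        {a : Fin n →₀ ℕ | a.support ⊆ insert x u} := by
      ext a
      simp only [Set.mem_ofPred_eq, Finset.subset_iff, Finsupp.mem_support_iff,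
        Finset.mem_insert, Finsupp.add_apply]
      constructor
      · exact fun h y hy => h (by omega)
      · intro h y hy
        by_cases hyx : y = x
        · exact Or.inl hyx
        · rw [Finsupp.single_eq_of_ne hyx, add_zero] at hy
          exact h hy
    rw [h1, h2, ih] at h
    rw [Finset.card_insert_of_notMem hx, pow_succ]
    linear_combination geom * h - countSeries {a : Fin n →₀ ℕ | a.support ⊆ insert x u} * geom_mul

theorem linearIndependent_mon : LinearIndependent K (mon K (n := n) (m := m)) := by
  classical
  rw [linearIndependent_iff']
  intro s c h u hu
  have := congrArg (fun f : Free K n m => coeff u.1 (f u.2)) h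
  simpa [Finset.sum_apply, coeff_sum, coeff_mon, hu] using this

theorem hilb_span_mon (e : Fin m → ℕ) (B : Set (Mon n m)) :
    hilb e (Submodule.span K (mon K '' B)) =
      ∑ j, PowerSeries.X ^ e j * countSeries {a | (a, j) ∈ B} := by
  classical
  ext z
  rw [map_sum, hilb, PowerSeries.coeff_mk]
  have h1 : (Submodule.span K (mon K '' B)).map (gr e z) =
      Submodule.span K (Set.range fun u : {u : Mon n m // u ∈ B ∧ u.1.degree + e u.2 = z} =>
        mon K u.1) := by
    refine le_antisymm ?_ ?_
    · rw [Submodule.map_span_le]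
      rintro _ ⟨u, hu, rfl⟩
      rw [gr_of_isHomog (isHomog_mon e u)]
      split_ifs with hz
      · exact Submodule.subset_span ⟨⟨u, hu, hz⟩, rfl⟩
      · exact zero_mem _
    · rw [Submodule.span_le]
      rintro _ ⟨⟨u, hu, hz⟩, rfl⟩
      refine ⟨mon K u, Submodule.subset_span ⟨u, hu, rfl⟩, ?_⟩
      rw [gr_of_isHomog (isHomog_mon e u), if_pos hz]
  have hli : LinearIndependent K fun u : {u : Mon n m // u ∈ B ∧ u.1.degree + e u.2 = z} =>
      mon K u.1 := linearIndependent_mon.comp _ Subtype.val_injective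
  rw [h1, Module.finrank_eq_nat_card_basis (Module.Basis.span hli)]
  let E : {u : Mon n m // u ∈ B ∧ u.1.degree + e u.2 = z} ≃
      Σ j, {a : Fin n →₀ ℕ // (a, j) ∈ B ∧ a.degree + e j = z} :=
    { toFun := fun u => ⟨u.1.2, u.1.1, u.2⟩
      invFun := fun v => ⟨(v.2.1, v.1), v.2.2⟩
      left_inv := fun _ => rfl
      right_inv := fun _ => rfl }
  have hfin : ∀ j, {a : Fin n →₀ ℕ | (a, j) ∈ B ∧ a.degree + e j = z}.Finite := fun j =>
    (Finsupp.finite_of_degree_le z).subset fun a ha => by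
      have := ha.2
      simp only [Set.mem_ofPred_eq]
      omega
  have : ∀ j, Finite {a : Fin n →₀ ℕ // (a, j) ∈ B ∧ a.degree + e j = z} := hfin
  rw [Nat.card_congr E, Nat.card_sigma, Nat.cast_sum]
  refine Finset.sum_congr rfl fun j _ => ?_
  rw [PowerSeries.coeff_X_pow_mul', countSeries]
  split_ifs with hj
  · rw [PowerSeries.coeff_mk, Nat.cast_inj]
    refine Nat.card_congr (Equiv.subtypeEquivRight fun a => and_congr_right fun _ => ?_)
    omega
  · rw [Nat.cast_eq_zero, Nat.card_eq_zero]
    exact Or.inl ⟨fun a => by have := a.2.2; omega⟩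

/-! ### Hilbert series of cones -/

/-- The Hilbert series of the free module of rank one, with the generator in degree `0`, is that of
the polynomial ring. -/
theorem hilb_span_mon_one (B : Set (Fin n →₀ ℕ)) :
    hilb 0 (Submodule.span K (mon K '' {u : Mon n 1 | u.1 ∈ B})) = countSeries B := by
  rw [hilb_span_mon]
  simp

/-- Multiplication `p ↦ p f`, as a map from the free module of rank one. -/
noncomputable def mulMap (f : Free K n m) :
    Free K n 1 →ₗ[MvPolynomial (Fin n) K] Free K n m :=
  (LinearMap.toSpanSingleton (MvPolynomial (Fin n) K) (Free K n m) f).comp (LinearMap.proj 0)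

@[simp] theorem mulMap_apply (f : Free K n m) (p : Free K n 1) : mulMap f p = p 0 • f := rfl

theorem range_mulMap (f : Free K n m) :
    LinearMap.range (mulMap f) = Submodule.span (MvPolynomial (Fin n) K) {f} := by
  rw [← LinearMap.range_toSpanSingleton, mulMap, LinearMap.range_comp_of_range_eq_top]
  rw [LinearMap.range_eq_top]
  exact fun p => ⟨fun _ => p, rfl⟩

theorem isGradedMap_mulMap {f : Free K n m} {δ : ℕ} (hf : IsHomog e f δ) :
    IsGradedMap 0 e δ ((mulMap f).restrictScalars K) := by
  refine isGradedMap_of_mon fun u => ?_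
  have h : mon K u 0 = monomial u.1 (1 : K) := by
    rw [mon, Subsingleton.elim u.2 0, Pi.single_eq_same]
  rw [LinearMap.coe_restrictScalars, mulMap_apply, h, Pi.zero_apply, add_zero]
  exact hf.smul (isHomogeneous_monomial _ rfl)

theorem Cone.space_eq (C : Cone K n e) :
    C.space = (Submodule.span K (mon K '' {u : Mon n 1 | u.1.support ⊆ C.vars})).map
      ((mulMap C.pivot).restrictScalars K) := by
  classical
  apply le_antisymm
  · rintro _ ⟨p, hp, rfl⟩
    refine ⟨fun _ => p, mem_span_mon fun u hu => ?_, rfl⟩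
    have hp' : p ∈ supported K (C.vars : Set (Fin n)) := hp
    rw [mem_supported] at hp'
    intro i hi
    exact Finset.mem_coe.1 (hp' (mem_vars_iff_mem_support i |>.2 ⟨u.1, mem_support_iff.2 hu, hi⟩))
  · rw [Submodule.map_span_le]
    rintro _ ⟨u, hu, rfl⟩
    refine ⟨mon K u 0, ?_, rfl⟩
    rw [mon, Subsingleton.elim u.2 0, Pi.single_eq_same]
    change monomial u.1 (1 : K) ∈ supported K (C.vars : Set (Fin n))
    rw [mem_supported, vars_monomial one_ne_zero]
    exact hu

theorem Cone.isGraded_space (C : Cone K n e) : IsGraded e C.space := by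
  rw [C.space_eq]
  exact (isGradedMap_mulMap C.isHomog_pivot).isGraded_map (isGraded_span_mon _ _)

theorem Cone.hilb_space (C : Cone K n e) :
    hilb e C.space = PowerSeries.X ^ C.deg * geom ^ C.dim := by
  have h := hilb_span_mon_one (K := K) {a : Fin n →₀ ℕ | a.support ⊆ C.vars}
  simp only [Set.mem_ofPred_eq] at h
  rw [C.space_eq, (isGradedMap_mulMap C.isHomog_pivot).hilb_map (isGraded_span_mon _ _),
    h, countSeries_support_subset, Cone.dim]
  intro p _ hp
  have h0 : p 0 = 0 := (smul_eq_zero.1 hp).resolve_right C.pivot_ne_zero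
  funext j
  rw [Subsingleton.elim j 0, h0, Pi.zero_apply]

/-- The shape of a finite set of cones. -/
def shape (P : Finset (Cone K n e)) : Multiset (ℕ × ℕ) := P.val.map fun C => (C.dim, C.deg)

theorem mem_shape {P : Finset (Cone K n e)} {a : ℕ × ℕ} :
    a ∈ shape P ↔ ∃ C ∈ P, (C.dim, C.deg) = a := by simp [shape]

theorem IsConeDecomposition.hilb_eq {P : Finset (Cone K n e)} {T : Submodule K (Free K n m)}
    (h : IsConeDecomposition P T) : hilb e T = hser (shape P) := by
  rw [← h.2, ← Finset.sup_univ_eq_iSup, hilb_finset_sup _ _ (fun C : P => C.1.isGraded_space)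
    (iSupIndep_iff_supIndep_univ.1 h.1), Finset.sum_coe_sort P fun C => hilb e C.space,
    hser, shape, Multiset.map_map]
  exact Finset.sum_congr rfl fun C _ => C.hilb_space

theorem IsStandard.std {q : ℕ} {P : Finset (Cone K n e)} {T : Submodule K (Free K n m)}
    (h : IsStandard q P T) : Std q (shape P) := by
  intro a ha hpos
  obtain ⟨C, hC, rfl⟩ := mem_shape.1 ha
  have hC' : C ∈ positiveCones P := Finset.mem_filter.2 ⟨hC, hpos⟩
  refine ⟨h.2.1 C hC', fun t h1 h2 => ?_⟩
  obtain ⟨C', hC', hd, hle⟩ := h.2.2 C hC' t h1 h2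
  exact ⟨_, mem_shape.2 ⟨C', hC', rfl⟩, hd, hle⟩

theorem IsExact.nodup {q : ℕ} {P : Finset (Cone K n e)} {T : Submodule K (Free K n m)}
    (h : IsExact q P T) : (((shape P).filter fun a => 0 < a.1).map Prod.snd).Nodup := by
  have : ((shape P).filter fun a => 0 < a.1).map Prod.snd =
      (positiveCones P).val.map Cone.deg := by
    rw [shape, Multiset.filter_map, Multiset.map_map, positiveCones, Finset.filter_val]
    rfl
  rw [this]
  refine Multiset.Nodup.map_on (fun C hC C' hC' hd => ?_) (positiveCones P).nodup
  by_contra hne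
  exact h.2 C hC C' hC' hne hd

/-! ### Normal forms -/

theorem MonOrder.normalForms_eq (o : MonOrder n m)
    (M : Submodule (MvPolynomial (Fin n) K) (Free K n m)) :
    o.normalForms M = Submodule.span K (mon K '' {u | mon K u ∉ o.initial M}) := by
  rw [MonOrder.normalForms]
  congr 1
  ext w
  exact exists_congr fun u => and_congr_right fun _ => eq_comm

theorem MonOrder.isGraded_normalForms (o : MonOrder n m)
    (M : Submodule (MvPolynomial (Fin n) K) (Free K n m)) : IsGraded e (o.normalForms M) := by
  rw [o.normalForms_eq]
  exact isGraded_span_mon _ _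

theorem MonOrder.IsInitial.monomial_smul {o : MonOrder n m} {f : Free K n m} {u : Mon n m}
    (h : o.IsInitial f u) (c : Fin n →₀ ℕ) :
    o.IsInitial (monomial c (1 : K) • f) (c + u.1, u.2) := by
  classical
  refine ⟨?_, fun v hv hne => ?_⟩
  · have h1 := h.1
    simp only [monomials, Set.mem_ofPred_eq, Pi.smul_apply, smul_eq_mul] at h1 ⊢
    rwa [coeff_monomial_mul, one_mul]
  · obtain ⟨c', a, hc', ha, hca⟩ := exists_of_mem_monomials_smul hv
    rw [coeff_monomial] at hc'
    obtain rfl : c = c' := by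
      by_contra h; simp [h] at hc'
    obtain ⟨v1, v2⟩ := v
    simp only at hca ha
    subst hca
    exact o.mul_lt c a u.1 v2 u.2 (h.2 _ ha fun h => hne (by rw [← h]))

/-- The monomials in the initial module are initial monomials of elements. -/
theorem MonOrder.exists_isInitial {o : MonOrder n m}
    {M : Submodule (MvPolynomial (Fin n) K) (Free K n m)} {u : Mon n m}
    (h : mon K u ∈ o.initial M) : ∃ f ∈ M, o.IsInitial f u := by
  suffices H : ∀ w ∈ o.initial M, ∀ u ∈ monomials w, ∃ f ∈ M, o.IsInitial f u from
    H _ h u (mem_monomials_mon.2 rfl)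
  intro w hw
  rw [MonOrder.initial] at hw
  induction hw using Submodule.span_induction with
  | mem x hx =>
    obtain ⟨f, hf, v, hv, rfl⟩ := hx
    intro u hu
    rw [mem_monomials_mon.1 hu]
    exact ⟨f, hf, hv⟩
  | zero => intro u hu; simp [monomials] at hu
  | add x y _ _ hx hy =>
    intro u hu
    exact (monomials_add_subset x y hu).elim (hx u) (hy u)
  | smul p x _ hx =>
    intro u hu
    obtain ⟨c, a, -, ha, hca⟩ := exists_of_mem_monomials_smul hu
    obtain ⟨f, hf, hfa⟩ := hx _ ha
    refine ⟨monomial c (1 : K) • f, M.smul_mem _ hf, ?_⟩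
    have := hfa.monomial_smul c
    rwa [hca] at this

theorem MonOrder.exists_isInitial_of_ne_zero (o : MonOrder n m) {f : Free K n m} (hf : f ≠ 0) :
    ∃ u, o.IsInitial f u := by
  classical
  have hw := o.isWellOrder
  have hfin : (monomials f).Finite := by
    refine (Set.finite_iUnion fun j : Fin m =>
      ((f j).support.finite_toSet.image fun a => (a, j))).subset ?_
    rintro ⟨a, j⟩ hu
    exact Set.mem_iUnion.2 ⟨j, a, mem_support_iff.2 hu, rfl⟩
  have hne : (monomials f).Nonempty := by
    by_contra h
    rw [Set.not_nonempty_iff_eq_empty] at h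
    refine hf (free_ext fun u => ?_)
    by_contra hu
    have : u ∈ monomials f := fun h0 => hu (by simp [h0])
    rw [h] at this
    exact this
  let lin : LinearOrder (Mon n m) := linearOrderOfSTO o.lt
  obtain ⟨u, hu, hmax⟩ := Set.exists_max_image (monomials f) id hfin hne
  refine ⟨u, hu, fun v hv hvu => ?_⟩
  exact @lt_of_le_of_ne _ lin.toPartialOrder _ _ (hmax v hv) hvu

/-- Macaulay's theorem: the free module is the direct sum of a submodule and its space of normal
forms. -/
theorem MonOrder.isCompl_normalForms (o : MonOrder n m)
    (M : Submodule (MvPolynomial (Fin n) K) (Free K n m)) :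
    IsCompl (o.normalForms M) (M.restrictScalars K) := by
  have hw := o.isWellOrder
  constructor
  · rw [Submodule.disjoint_def]
    intro f hf hfM
    by_contra hne
    obtain ⟨u, hu⟩ := o.exists_isInitial_of_ne_zero hne
    obtain ⟨-, -, h⟩ := (mem_normalForms_iff o M f).1 hf
    exact h u hu.1 (Submodule.subset_span ⟨f, hfM, u, hu, rfl⟩)
  · rw [codisjoint_iff, eq_top_iff, ← span_range_mon, Submodule.span_le]
    rintro _ ⟨u, rfl⟩
    induction u using hw.wf.induction with
    | _ u ih =>
    by_cases hu : mon K u ∈ o.initial M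
    · obtain ⟨f, hf, hfu⟩ := o.exists_isInitial hu
      set c := coeff u.1 (f u.2)
      have hc : c ≠ 0 := hfu.1
      have key : mon K u = (mon K u - c⁻¹ • f) + c⁻¹ • f := by abel
      rw [key]
      refine add_mem ?_ (Submodule.mem_sup_right (Submodule.smul_mem _ _ hf))
      refine Submodule.span_le.2 ?_ (mem_span_mon (B := {v | o.lt v u}) fun v hv => ?_)
      · rintro _ ⟨v, hv, rfl⟩
        exact ih v hv
      · simp only [monomials, Set.mem_ofPred_eq, Pi.sub_apply, Pi.smul_apply, coeff_sub,
          coeff_smul, coeff_mon, smul_eq_mul] at hv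
        have hvu : v ≠ u := by
          rintro rfl
          rw [if_pos rfl, inv_mul_cancel₀ hc, sub_self] at hv
          exact hv rfl
        refine hfu.2 v ?_ hvu
        rw [if_neg hvu, zero_sub, neg_ne_zero] at hv
        exact right_ne_zero_of_mul hv
    · exact Submodule.mem_sup_left (Submodule.subset_span ⟨u, hu, rfl⟩)

theorem MonOrder.hilb_normalForms_add (o : MonOrder n m)
    {M : Submodule (MvPolynomial (Fin n) K) (Free K n m)} (hM : IsGraded e (M.restrictScalars K)) :
    hilb e (o.normalForms M) + hilb e (M.restrictScalars K) =
      hilb e (⊤ : Submodule K (Free K n m)) := by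
  rw [← hilb_sup (o.isGraded_normalForms M) hM (o.isCompl_normalForms M).disjoint,
    (o.isCompl_normalForms M).sup_eq_top]

/-- The exact sequence `0 → F' / φ⁻¹(M) → F / M → F / (M + im φ) → 0` for a graded homomorphism
`φ : F' → F`, in terms of Hilbert series of spaces of normal forms. -/
theorem hilb_normalForms_sup_range {m' : ℕ} {e' : Fin m' → ℕ} {δ : ℕ} (o : MonOrder n m)
    (o' : MonOrder n m') {M : Submodule (MvPolynomial (Fin n) K) (Free K n m)}
    (hM : IsGraded e (M.restrictScalars K))
    {φ : Free K n m' →ₗ[MvPolynomial (Fin n) K] Free K n m}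
    (hφ : IsGradedMap e' e δ (φ.restrictScalars K)) :
    IsGraded e ((M ⊔ LinearMap.range φ).restrictScalars K) ∧
    hilb e (o.normalForms M) = hilb e (o.normalForms (M ⊔ LinearMap.range φ)) +
      PowerSeries.X ^ δ * hilb e' (o'.normalForms (M.comap φ)) := by
  set N := o'.normalForms (M.comap φ) with hN
  have hNc := o'.isCompl_normalForms (M.comap φ)
  have hinj : ∀ f ∈ N, φ f ∈ M → f = 0 := fun f hf h =>
    (Submodule.disjoint_def.1 hNc.disjoint) f hf h
  have hsup : (M ⊔ LinearMap.range φ).restrictScalars K =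
      M.restrictScalars K ⊔ N.map (φ.restrictScalars K) := by
    apply le_antisymm
    · intro x hx
      obtain ⟨y, hy, _, ⟨f, rfl⟩, rfl⟩ := Submodule.mem_sup.1 hx
      obtain ⟨g, hg, h, hh, rfl⟩ := Submodule.mem_sup.1
        (hNc.sup_eq_top ▸ Submodule.mem_top : f ∈ N ⊔ _)
      rw [map_add, add_comm (φ g), ← add_assoc]
      exact add_mem (Submodule.mem_sup_left (add_mem hy hh))
        (Submodule.mem_sup_right ⟨g, hg, rfl⟩)
    · refine sup_le (fun x hx => Submodule.mem_sup_left hx) ?_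
      rintro _ ⟨f, -, rfl⟩
      exact Submodule.mem_sup_right ⟨f, rfl⟩
  have hNg : IsGraded e' N := o'.isGraded_normalForms _
  have hdisj : Disjoint (M.restrictScalars K) (N.map (φ.restrictScalars K)) := by
    rw [Submodule.disjoint_def]
    rintro _ hx ⟨f, hf, rfl⟩
    rw [hinj f hf hx, map_zero]
  have hg : IsGraded e ((M ⊔ LinearMap.range φ).restrictScalars K) := by
    rw [hsup]
    intro z
    rw [Submodule.map_sup]
    exact sup_le_sup (hM z) (hφ.isGraded_map hNg z)
  refine ⟨hg, ?_⟩
  have h1 := o.hilb_normalForms_add hM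
  have h2 := o.hilb_normalForms_add hg
  rw [hsup, hilb_sup hM (hφ.isGraded_map hNg) hdisj, hφ.hilb_map hNg fun f hf h0 =>
    hinj f hf (by rw [show φ f = 0 from h0]; exact M.zero_mem)] at h2
  linear_combination h1 - h2

/-! ### Standard shapes for quotients of the polynomial ring -/

/-- The shape of the translate of a set of cones by an element of degree `δ`. -/
def shift (δ : ℕ) (A : Multiset (ℕ × ℕ)) : Multiset (ℕ × ℕ) := A.map fun a => (a.1, a.2 + δ)

theorem mem_shift {δ : ℕ} {A : Multiset (ℕ × ℕ)} {a : ℕ × ℕ} :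
    a ∈ shift δ A ↔ ∃ b ∈ A, (b.1, b.2 + δ) = a := by simp [shift]

theorem hser_shift (δ : ℕ) (A : Multiset (ℕ × ℕ)) :
    hser (shift δ A) = PowerSeries.X ^ δ * hser A := by
  induction A using Multiset.induction_on with
  | empty => simp [shift]
  | cons a A ih =>
    rw [shift, Multiset.map_cons, hser_cons, ← shift, ih, hser_cons]
    ring

theorem Std.shift {q : ℕ} {A : Multiset (ℕ × ℕ)} (hA : Std q A) (δ : ℕ) :
    Std (q + δ) (shift δ A) := by
  intro a ha hpos
  obtain ⟨b, hb, rfl⟩ := mem_shift.1 ha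
  obtain ⟨h1, h2⟩ := hA b hb hpos
  refine ⟨by simpa using h1, fun t ht hta => ?_⟩
  simp only at hta
  obtain ⟨c, hc, hct, hbc⟩ := h2 (t - δ) (by omega) (by omega)
  exact ⟨_, mem_shift.2 ⟨c, hc, rfl⟩, by simp only; omega, hbc⟩

/-- The ideal `I` contains no monomial in the variables of `s`; for a monomial ideal this means
that the cone `K[s]` consists of normal forms modulo `I`. -/
def IsFree (I : Ideal (MvPolynomial (Fin n) K)) (s : Finset (Fin n)) : Prop :=
  ∀ a : Fin n →₀ ℕ, a.support ⊆ s → monomial a (1 : K) ∉ I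

theorem IsFree.anti {I I' : Ideal (MvPolynomial (Fin n) K)} {s : Finset (Fin n)} (h : I ≤ I')
    (hs : IsFree I' s) : IsFree I s := fun a ha hI => hs a ha (h hI)

/-- The ideal quotient by a variable. -/
noncomputable def colonX (I : Ideal (MvPolynomial (Fin n) K)) (x : Fin n) : Ideal (MvPolynomial (Fin n) K) :=
  Submodule.comap (LinearMap.lsmul _ _ (X x)) I

theorem monomial_mem_colonX {I : Ideal (MvPolynomial (Fin n) K)} {x : Fin n} {a : Fin n →₀ ℕ} :
    monomial a (1 : K) ∈ colonX I x ↔ monomial (a + Finsupp.single x 1) (1 : K) ∈ I := by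
  rw [colonX, Submodule.mem_comap, LinearMap.lsmul_apply, smul_eq_mul, X, monomial_mul, one_mul,
    add_comm]

/-- Dividing by a variable outside a maximal free set enlarges the ideal. -/
theorem lt_colonX {I : Ideal (MvPolynomial (Fin n) K)} {s : Finset (Fin n)} {x : Fin n}
    (hs : IsFree I s) (hx : ¬ IsFree I (insert x s)) : I < colonX I x := by
  refine lt_of_le_of_ne (fun p hp => I.mul_mem_left _ hp) fun heq => ?_
  -- a monomial of `I` in the variables `s ∪ {x}` with the least exponent of `x`
  have hex : ∃ k, ∃ a : Fin n →₀ ℕ, a.support ⊆ insert x s ∧ monomial a (1 : K) ∈ I ∧ a x = k := by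
    simp only [IsFree, not_forall, not_not] at hx
    obtain ⟨a, ha, haI⟩ := hx
    exact ⟨_, a, ha, haI, rfl⟩
  classical
  obtain ⟨a, ha, haI, hax⟩ := Nat.find_spec hex
  by_cases h0 : a x = 0
  · exact hs a ((Finset.subset_insert_iff_of_notMem (by simpa using h0)).1 ha) haI
  · have hle : Finsupp.single x 1 ≤ a := by simpa [Nat.one_le_iff_ne_zero] using h0
    refine Nat.find_min hex (m := a x - 1) (by omega) ⟨a - Finsupp.single x 1, ?_, ?_, ?_⟩
    · exact (Finsupp.support_mono tsub_le_self).trans ha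
    · rwa [heq, monomial_mem_colonX, tsub_add_cancel_of_le hle]
    · simp

/-- The monomials in the variables of `u` outside of an ideal `I` have the Hilbert series of a
`0`-standard shape. The induction also records that the dimensions in the shape are bounded by the
sizes of the free sets of variables, and that in degree `0` this bound is attained. -/
theorem exists_std_countSeries (I : Ideal (MvPolynomial (Fin n) K)) (u : Finset (Fin n)) :
    ∃ A, Std 0 A ∧ hser A = countSeries {a | a.support ⊆ u ∧ monomial a (1 : K) ∉ I} ∧
      (∀ a ∈ A, ∃ s ⊆ u, IsFree I s ∧ a.1 ≤ s.card) ∧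
      ∀ s ⊆ u, IsFree I s → ∃ a ∈ A, a.2 = 0 ∧ s.card ≤ a.1 := by
  classical
  induction I using WellFoundedGT.induction generalizing u with
  | _ I ihI =>
  induction u using Finset.strongInduction with
  | _ u ihu =>
  by_cases h0 : IsFree I ∅
  swap
  · -- the unit ideal
    have h1 : monomial 0 (1 : K) ∈ I := by
      simp only [IsFree, not_forall, not_not, Finset.subset_empty, Finsupp.support_eq_empty] at h0
      obtain ⟨a, rfl, h⟩ := h0
      exact h
    have h2 : I = ⊤ := (Ideal.eq_top_iff_one I).2 h1
    refine ⟨0, by simp [Std], ?_, by simp, fun s _ hfree => absurd h1 (hfree 0 (by simp))⟩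
    rw [h2, hser_zero, ← countSeries_empty]
    congr 1
    ext a
    simp
  by_cases hu : IsFree I u
  · -- a single cone
    refine ⟨{(u.card, 0)}, ?_, ?_, ?_, ?_⟩
    · intro a ha _
      rw [Multiset.mem_singleton] at ha
      subst ha
      exact ⟨le_rfl, fun t _ ht => ⟨_, Multiset.mem_singleton_self _, by simp only at ht ⊢; omega,
        le_rfl⟩⟩
    · rw [← Multiset.cons_zero, hser_cons, hser_zero, pow_zero, one_mul, add_zero,
        ← countSeries_support_subset]
      congr 1
      ext a
      exact ⟨fun h => ⟨h, hu a h⟩, fun h => h.1⟩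
    · intro a ha
      rw [Multiset.mem_singleton] at ha
      exact ⟨u, subset_rfl, hu, by rw [ha]⟩
    · exact fun s hs _ => ⟨_, Multiset.mem_singleton_self _, rfl, Finset.card_le_card hs⟩
  -- split off a variable `x` outside a free set `s` of the largest size
  obtain ⟨s, hs, hmax⟩ := (u.powerset.filter fun s => IsFree I s).exists_max_image Finset.card
    ⟨∅, by simp [h0]⟩
  simp only [Finset.mem_filter, Finset.mem_powerset, and_imp] at hs hmax
  obtain ⟨hsu, hsfree⟩ := hs
  obtain ⟨x, hxu, hxs⟩ : ∃ x ∈ u, x ∉ s := by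
    by_contra! h
    exact hu (hsu.antisymm h ▸ hsfree)
  have hlt : I < colonX I x := lt_colonX hsfree fun h => by
    have := hmax _ (Finset.insert_subset hxu hsu) h
    rw [Finset.card_insert_of_notMem hxs] at this
    omega
  obtain ⟨A, hAstd, hAser, hAdim, hAtop⟩ := ihu (u.erase x) (Finset.erase_ssubset hxu)
  obtain ⟨B, hBstd, hBser, hBdim, -⟩ := ihI (colonX I x) hlt u
  have hsx : s ⊆ u.erase x := Finset.subset_erase.2 ⟨hsu, hxs⟩
  obtain ⟨t, ht, ht0, hst⟩ := hAtop s hsx hsfree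
  have hBstd' := hBstd.shift 1
  refine ⟨A + shift 1 B, ?_, ?_, ?_, ?_⟩
  · intro a ha hpos
    rcases Multiset.mem_add.1 ha with ha | ha
    · refine ⟨Nat.zero_le _, fun d hd hda => ?_⟩
      obtain ⟨b, hb, h⟩ := (hAstd a ha hpos).2 d hd hda
      exact ⟨b, Multiset.mem_add.2 (Or.inl hb), h⟩
    · refine ⟨Nat.zero_le _, fun d hd hda => ?_⟩
      rcases Nat.eq_zero_or_pos d with rfl | hd'
      · refine ⟨t, Multiset.mem_add.2 (Or.inl ht), ht0, ?_⟩
        obtain ⟨b, hb, rfl⟩ := mem_shift.1 ha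
        obtain ⟨s', hs'u, hs', hle⟩ := hBdim b hb
        exact hle.trans ((hmax s' hs'u (hs'.anti hlt.le)).trans hst)
      · obtain ⟨b, hb, h⟩ := (hBstd' a ha hpos).2 d (by omega) hda
        exact ⟨b, Multiset.mem_add.2 (Or.inr hb), h⟩
  · rw [hser_add, hser_shift, hAser, hBser, pow_one,
      countSeries_split {a | a.support ⊆ u ∧ monomial a (1 : K) ∉ I} x]
    congr 3
    · ext a
      simp only [Set.mem_ofPred_eq, Finset.subset_erase, Finsupp.mem_support_iff, not_not]
      tauto
    · ext a
      simp only [Set.mem_ofPred_eq, monomial_mem_colonX]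
      refine and_congr_left fun _ => ?_
      have hsupp : (a + Finsupp.single x 1).support = a.support ∪ {x} := by
        ext y
        by_cases hy : y = x
        · simp [hy]
        · simp [hy, Finsupp.single_eq_of_ne hy]
      rw [hsupp, Finset.union_subset_iff]
      simp [hxu]
  · intro a ha
    rcases Multiset.mem_add.1 ha with ha | ha
    · obtain ⟨s', hs', h⟩ := hAdim a ha
      exact ⟨s', hs'.trans (Finset.erase_subset x u), h⟩
    · obtain ⟨b, hb, rfl⟩ := mem_shift.1 ha
      obtain ⟨s', hs', hfree, h⟩ := hBdim b hb
      exact ⟨s', hs', hfree.anti hlt.le, h⟩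
  · exact fun s' hs' hfree =>
      ⟨t, Multiset.mem_add.2 (Or.inl ht), ht0, (hmax s' hs' hfree).trans hst⟩

/-- The normal forms modulo an ideal have the Hilbert series of a `0`-standard shape. -/
theorem MonOrder.exists_std_hilb_normalForms (o : MonOrder n 1)
    (N : Submodule (MvPolynomial (Fin n) K) (Free K n 1)) :
    ∃ A, Std 0 A ∧ hilb 0 (o.normalForms N) = hser A := by
  obtain ⟨A, hA, hser, -⟩ := exists_std_countSeries
    (Submodule.comap (LinearMap.single (MvPolynomial (Fin n) K)
      (fun _ : Fin 1 => MvPolynomial (Fin n) K) 0) (o.initial N)) Finset.univ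
  refine ⟨A, hA, ?_⟩
  rw [hser, o.normalForms_eq, ← hilb_span_mon_one (K := K)]
  congr 3
  ext ⟨a, j⟩
  rw [Subsingleton.elim j 0]
  simp [mon]

/-- The order on the monomials of `S` induced by the order on the monomials of `S e_j`. -/
def MonOrder.restrict (o : MonOrder n m) (j : Fin m) : MonOrder n 1 where
  lt u v := o.lt (u.1, j) (v.1, j)
  isWellOrder := by
    have := o.isWellOrder
    have hinj : Function.Injective fun u : Mon n 1 => ((u.1, j) : Mon n m) := by
      rintro ⟨a, i⟩ ⟨b, i'⟩ h
      simp only [Prod.mk.injEq, and_true] at h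
      exact Prod.ext h (Subsingleton.elim _ _)
    exact RelEmbedding.isWellOrder (⟨⟨_, hinj⟩, Iff.rfl⟩ :
      (fun u v : Mon n 1 => o.lt (u.1, j) (v.1, j)) ↪r o.lt)
  mul_lt c a b _ _ h := o.mul_lt c a b j j h

/-- Passing from `M` to `M + ∑ S f_i` removes a `D`-standard shape from the normal forms, if the
degrees of the `f_i` are at most `D`: the part removed by `f_i` has the shape of the normal forms
modulo the ideal `(M_{i-1} : f_i)`, translated by `deg f_i`. -/
theorem MonOrder.exists_std_hilb_sup_span (o : MonOrder n m) (o' : MonOrder n 1)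
    {M : Submodule (MvPolynomial (Fin n) K) (Free K n m)} (hM : IsGraded e (M.restrictScalars K))
    {ι : Type*} {f : ι → Free K n m} {δ : ι → ℕ} (hf : ∀ i, IsHomog e (f i) (δ i)) {D : ℕ}
    (hD : ∀ i, δ i ≤ D) (s : Finset ι) :
    IsGraded e ((M ⊔ Submodule.span _ (f '' s)).restrictScalars K) ∧
    ∃ T, Std D T ∧ hilb e (o.normalForms M) =
      hilb e (o.normalForms (M ⊔ Submodule.span _ (f '' s))) + hser T := by
  classical
  induction s using Finset.induction_on with
  | empty => simpa using ⟨hM, 0, by simp [Std], by simp⟩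
  | insert i s _ ih =>
    obtain ⟨hg, T, hT, hTeq⟩ := ih
    obtain ⟨hg', heq⟩ := hilb_normalForms_sup_range o o' hg (isGradedMap_mulMap (hf i))
    have hsup : M ⊔ Submodule.span (MvPolynomial (Fin n) K) (f '' ↑(insert i s)) =
        M ⊔ Submodule.span _ (f '' s) ⊔ LinearMap.range (mulMap (f i)) := by
      rw [range_mulMap, Finset.coe_insert, Set.image_insert_eq, Submodule.span_insert,
        sup_comm (Submodule.span _ {f i}), sup_assoc]
    rw [hsup]
    obtain ⟨A, hA, hAeq⟩ := o'.exists_std_hilb_normalForms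
      ((M ⊔ Submodule.span _ (f '' s)).comap (mulMap (f i)))
    obtain ⟨A', hA', hA'eq, -⟩ := (hA.shift (δ i)).exists_of_le
      (show 0 + δ i ≤ D by simpa using hD i)
    refine ⟨hg', T + A', hT.add hA', ?_⟩
    rw [hTeq, heq, hAeq, hser_add, hA'eq, hser_shift]
    ring

/-! ### Regular sequences -/

theorem mem_smul_top_iff (I : Ideal (MvPolynomial (Fin n) K)) (f : Free K n m) :
    f ∈ I • (⊤ : Submodule (MvPolynomial (Fin n) K) (Free K n m)) ↔ ∀ j, f j ∈ I := by
  constructor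
  · intro h j
    induction h using Submodule.smul_induction_on' with
    | smul r hr g _ => exact I.mul_mem_right _ hr
    | add x _ y _ hx hy => exact I.add_mem hx hy
  · intro h
    have : f = ∑ j, f j • (Pi.single j 1 : Free K n m) := by
      conv_lhs => rw [← Finset.univ_sum_single f]
      refine Finset.sum_congr rfl fun j _ => ?_
      rw [← Pi.single_smul', smul_eq_mul, mul_one]
    rw [this]
    exact Submodule.sum_mem _ fun j _ => Submodule.smul_mem_smul (h j) trivial

theorem hilb_top (e : Fin m → ℕ) : hilb e (⊤ : Submodule K (Free K n m)) =
    (∑ j, PowerSeries.X ^ e j) * geom ^ n := by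
  have h1 : countSeries (Set.univ : Set (Fin n →₀ ℕ)) = geom ^ n := by
    have := countSeries_support_subset (Finset.univ : Finset (Fin n))
    simpa [Finset.card_fin] using this
  rw [← span_range_mon, ← Set.image_univ, hilb_span_mon, Finset.sum_mul]
  simp [h1]

/-- The ideal generated by the first `i` members of a sequence. -/
noncomputable def initIdeal {k : ℕ} (g : Fin k → MvPolynomial (Fin n) K) (i : ℕ) :
    Ideal (MvPolynomial (Fin n) K) :=
  Ideal.span (g '' {j | j.1 < i})

/-- The Hilbert series of `F / (g_1, …, g_k) F` for a homogeneous (weakly) regular sequence. -/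
theorem MonOrder.hilb_normalForms_of_regular (o : MonOrder n m) {k : ℕ}
    {g : Fin k → MvPolynomial (Fin n) K} {d : Fin k → ℕ} (hg : ∀ i, (g i).IsHomogeneous (d i))
    (hreg : ∀ i p, g i * p ∈ initIdeal g i.1 → p ∈ initIdeal g i.1) :
    IsGraded e ((Ideal.span (Set.range g) •
      (⊤ : Submodule (MvPolynomial (Fin n) K) (Free K n m))).restrictScalars K) ∧
    hilb e (o.normalForms (Ideal.span (Set.range g) •
      (⊤ : Submodule (MvPolynomial (Fin n) K) (Free K n m)))) =
      (∏ i, (1 - PowerSeries.X ^ d i)) * ((∑ j, PowerSeries.X ^ e j) * geom ^ n) := by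
  suffices H : ∀ i ≤ k, IsGraded e ((initIdeal g i •
      (⊤ : Submodule (MvPolynomial (Fin n) K) (Free K n m))).restrictScalars K) ∧
      hilb e (o.normalForms (initIdeal g i •
        (⊤ : Submodule (MvPolynomial (Fin n) K) (Free K n m)))) =
        (∏ j with j.1 < i, (1 - PowerSeries.X ^ d j)) *
          ((∑ j, PowerSeries.X ^ e j) * geom ^ n) by
    have h1 : initIdeal g k = Ideal.span (Set.range g) := by
      rw [initIdeal, ← Set.image_univ]
      congr 2
      ext j
      simp
    have h2 : (Finset.univ.filter fun j : Fin k => j.1 < k) = Finset.univ := by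
      ext j
      simp
    have := H k le_rfl
    rwa [h1, h2] at this
  intro i
  induction i with
  | zero =>
    intro _
    have h0 : initIdeal g 0 • (⊤ : Submodule (MvPolynomial (Fin n) K) (Free K n m)) = ⊥ := by
      simp [initIdeal]
    have hb : IsGraded e ((⊥ : Submodule (MvPolynomial (Fin n) K)
        (Free K n m)).restrictScalars K) := isGraded_bot
    rw [h0]
    refine ⟨hb, ?_⟩
    have h1 := o.hilb_normalForms_add hb
    rw [Submodule.restrictScalars_bot, hilb_bot, add_zero, hilb_top] at h1
    rw [h1]
    simp
  | succ i ih =>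
    intro hi
    obtain ⟨hgr, heq⟩ := ih (by omega)
    set φ : Free K n m →ₗ[MvPolynomial (Fin n) K] Free K n m :=
      LinearMap.lsmul _ _ (g ⟨i, hi⟩) with hφ
    have hφg : IsGradedMap e e (d ⟨i, hi⟩) (φ.restrictScalars K) :=
      isGradedMap_of_mon fun u => by
        rw [add_comm]
        exact (isHomog_mon e u).smul (hg ⟨i, hi⟩)
    obtain ⟨hgr', heq'⟩ := hilb_normalForms_sup_range o o hgr hφg
    have hset : {j : Fin k | j.1 < i + 1} = insert ⟨i, hi⟩ {j : Fin k | j.1 < i} := by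
      ext j
      simp only [Set.mem_ofPred_eq, Set.mem_insert_iff, Fin.ext_iff]
      omega
    have hsup : initIdeal g (i + 1) • (⊤ : Submodule (MvPolynomial (Fin n) K) (Free K n m)) =
        initIdeal g i • ⊤ ⊔ LinearMap.range φ := by
      rw [initIdeal, hset, Set.image_insert_eq, Ideal.span_insert, Submodule.sup_smul, sup_comm]
      congr 1
      rw [Submodule.ideal_span_singleton_smul]
      ext f
      simp [Submodule.mem_smul_pointwise_iff_exists, hφ]
    have hcomap : (initIdeal g i • (⊤ : Submodule (MvPolynomial (Fin n) K) (Free K n m))).comap φ =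
        initIdeal g i • ⊤ := by
      ext f
      rw [Submodule.mem_comap, mem_smul_top_iff, mem_smul_top_iff]
      exact forall_congr' fun j => ⟨hreg ⟨i, hi⟩ _, fun h => Ideal.mul_mem_left _ _ h⟩
    have hfin : (Finset.univ.filter fun j : Fin k => j.1 < i + 1) =
        insert ⟨i, hi⟩ (Finset.univ.filter fun j : Fin k => j.1 < i) := by
      ext j
      simp only [Finset.mem_filter, Finset.mem_univ, true_and, Finset.mem_insert, Fin.ext_iff]
      omega
    rw [← hsup] at hgr' heq'
    refine ⟨hgr', ?_⟩
    rw [hcomap, heq] at heq'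
    rw [hfin, Finset.prod_insert (by simp)]
    linear_combination -heq'

theorem mem_initIdeal_of_isRegular {k : ℕ} {g : Fin k → MvPolynomial (Fin n) K}
    (hreg : RingTheory.Sequence.IsRegular (MvPolynomial (Fin n) K) (List.ofFn g)) (i : Fin k)
    (p : MvPolynomial (Fin n) K) (h : g i * p ∈ initIdeal g i.1) : p ∈ initIdeal g i.1 := by
  have h1 := hreg.regular_mod_prev i.1 (by simp)
  rw [isSMulRegular_quotient_iff_mem_of_smul_mem] at h1
  have h2 : (Ideal.ofList ((List.ofFn g).take i.1) •
      (⊤ : Submodule (MvPolynomial (Fin n) K) (MvPolynomial (Fin n) K))) = initIdeal g i.1 := by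
    rw [smul_eq_mul, Ideal.mul_top, initIdeal, Ideal.ofList]
    congr 1
    ext q
    simp only [Set.mem_ofPred_eq, List.mem_take_iff_getElem, List.getElem_ofFn, List.length_ofFn,
      Set.mem_image]
    constructor
    · rintro ⟨j, hj, rfl⟩
      exact ⟨⟨j, by omega⟩, by simp only; omega, rfl⟩
    · rintro ⟨j, hj, rfl⟩
      exact ⟨j.1, by omega, rfl⟩
  rw [h2] at h1
  refine h1 p ?_
  simpa using h

/-- Powers of distinct variables form a regular sequence. -/
theorem mem_initIdeal_X_pow {k : ℕ} {v : Fin k → Fin n} (hv : Function.Injective v)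
    (d : Fin k → ℕ) (i : Fin k) (p : MvPolynomial (Fin n) K)
    (h : (X (v i) : MvPolynomial (Fin n) K) ^ d i * p ∈
      initIdeal (fun j => (X (v j) : MvPolynomial (Fin n) K) ^ d j) i.1) :
    p ∈ initIdeal (fun j => (X (v j) : MvPolynomial (Fin n) K) ^ d j) i.1 := by
  have himg : initIdeal (fun j => (X (v j) : MvPolynomial (Fin n) K) ^ d j) i.1 =
      Ideal.span ((fun a => monomial a (1 : K)) ''
        ((fun j => Finsupp.single (v j) (d j)) '' {j | j.1 < i.1})) := by
    rw [initIdeal, Set.image_image]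
    simp only [X_pow_eq_monomial]
  rw [himg, mem_ideal_span_monomial_image] at h ⊢
  intro a ha
  obtain ⟨-, ⟨j, hj, rfl⟩, hle⟩ := h (Finsupp.single (v i) (d i) + a) (by
    rw [mem_support_iff, X_pow_eq_monomial, coeff_monomial_mul, one_mul]
    exact mem_support_iff.1 ha)
  refine ⟨_, ⟨j, hj, rfl⟩, ?_⟩
  have hij : v j ≠ v i := fun h => by
    have := hv h
    subst this
    exact lt_irrefl j.1 hj
  rw [Finsupp.single_le_iff] at hle ⊢
  rwa [Finsupp.add_apply, Finsupp.single_eq_of_ne hij, zero_add] at hle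

end ConeDec

/-! ### The degree bound for modules -/

open ConeDec in
theorem theorem6p4 {K : Type*} [Field K] (n r m s : ℕ) (hr : r ≤ n)
    (e : Fin m → ℕ) (o : ConeDec.MonOrder n m)
    (g : Fin (n - r) → MvPolynomial (Fin n) K) (d : Fin (n - r) → ℕ)
    (hg : ∀ i, (g i).IsHomogeneous (d i))
    (hreg : RingTheory.Sequence.IsRegular (MvPolynomial (Fin n) K) (List.ofFn g))
    (f : Fin s → ConeDec.Free K n m) (δ : Fin s → ℕ) (hf : ∀ i, ConeDec.IsHomog e (f i) (δ i))
    (l : ℕ) (hl : l = Finset.univ.sup e) (D : ℕ) (hδ : ∀ i, δ i ≤ D) (hD : l ≤ D)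
    (M : Submodule (MvPolynomial (Fin n) K) (ConeDec.Free K n m))
    (hM : M = Submodule.span (MvPolynomial (Fin n) K)
      ({w | ∃ i j, w = g i • (Pi.single j 1 : ConeDec.Free K n m)} ∪ Set.range f))
    (hMF : M ≠ ⊤)
    (J : Ideal (MvPolynomial (Fin n) K))
    (hJ : J = Ideal.span
      (Set.range fun i : Fin (n - r) =>
        (MvPolynomial.X (Fin.castLE (Nat.sub_le n r) i) : MvPolynomial (Fin n) K) ^ d i))
    (Q : Finset (ConeDec.Cone K n e)) (hQ : ConeDec.IsStandard l Q (o.normalForms M))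
    (P : Finset (ConeDec.Cone K n e))
    (hP : ConeDec.IsExact D P
      (o.normalForms (J • (⊤ : Submodule (MvPolynomial (Fin n) K) (ConeDec.Free K n m))))) :
    1 + ConeDec.degree Q ≤
      max (1 + ConeDec.degree (ConeDec.positiveCones P))
        ((((∑ i, (d i : ℤ)) + l - n + 1 : ℤ)) : WithBot ℤ) := by
  obtain ⟨j₀⟩ : Nonempty (Fin m) := by
    by_contra h
    rw [not_nonempty_iff] at h
    exact hMF (Subsingleton.elim _ _)
  -- the modules generated by the two regular sequences have the same Hilbert series
  obtain ⟨hgr, hgs⟩ := o.hilb_normalForms_of_regular (e := e) hg (mem_initIdeal_of_isRegular hreg)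
  obtain ⟨-, hJs⟩ := o.hilb_normalForms_of_regular (e := e)
    (g := fun i => (MvPolynomial.X (Fin.castLE (Nat.sub_le n r) i) : MvPolynomial (Fin n) K) ^ d i)
    (d := d) (fun i => MvPolynomial.isHomogeneous_X_pow _ _)
    (mem_initIdeal_X_pow (Fin.castLE_injective _) d)
  rw [← hJ, hP.1.1.hilb_eq] at hJs
  -- `M` arises from the first one by adjoining the `f i`
  have hMsup : M = Ideal.span (Set.range g) • ⊤ ⊔
      Submodule.span (MvPolynomial (Fin n) K) (f '' (Finset.univ : Finset (Fin s))) := by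
    have htop : (⊤ : Submodule (MvPolynomial (Fin n) K) (Free K n m)) =
        Submodule.span _ (Set.range fun j => Pi.single j 1) := by
      rw [← (Pi.basisFun (MvPolynomial (Fin n) K) (Fin m)).span_eq]
      congr 2
      ext1 j
      simp
    rw [hM, Submodule.span_union, Finset.coe_univ, Set.image_univ, htop, Submodule.span_smul_span]
    congr 2
    ext w
    simp only [Set.mem_ofPred_eq, Set.mem_smul, Set.mem_range, exists_exists_eq_and]
    simp only [eq_comm]
  obtain ⟨-, T, hT, hTs⟩ := o.exists_std_hilb_sup_span (o.restrict j₀) hgr hf hδ Finset.univ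
  rw [← hMsup, hgs, ← hJs, hQ.1.hilb_eq] at hTs
  set p : Polynomial ℤ :=
    (∏ i, (1 - Polynomial.X ^ d i)) * ∑ j, Polynomial.X ^ e j with hp
  have hpP : hser (shape P) = (p : PowerSeries ℤ) * geom ^ n := by
    have h1 : ((∏ i, (1 - Polynomial.X ^ d i) : Polynomial ℤ) : PowerSeries ℤ) =
        ∏ i, (1 - PowerSeries.X ^ d i) := by
      rw [← Polynomial.coeToPowerSeries.ringHom_apply, map_prod]
      simp
    have h2 : ((∑ j, Polynomial.X ^ e j : Polynomial ℤ) : PowerSeries ℤ) =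
        ∑ j, PowerSeries.X ^ e j := by
      rw [← Polynomial.coeToPowerSeries.ringHom_apply, map_sum]
      simp
    rw [hJs, hp, Polynomial.coe_mul, h1, h2]
    ring
  have hpdeg : p.natDegree ≤ ∑ i, d i + l := by
    refine Polynomial.natDegree_mul_le.trans (add_le_add ?_ ?_)
    · refine (Polynomial.natDegree_prod_le _ _).trans (Finset.sum_le_sum fun i _ => ?_)
      refine (Polynomial.natDegree_sub_le _ _).trans ?_
      simp
    · refine Polynomial.natDegree_sum_le_of_forall_le _ _ fun j _ => ?_
      rw [Polynomial.natDegree_X_pow, hl]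
      exact Finset.le_sup (Finset.mem_univ j)
  rcases Q.eq_empty_or_nonempty with rfl | hne
  · simp [degree]
  obtain ⟨C, hC, hCdeg⟩ : ∃ C ∈ Q, degree Q = ((C.deg : ℤ) : WithBot ℤ) :=
    Finset.exists_mem_eq_sup Q hne fun C => ((C.deg : ℤ) : WithBot ℤ)
  by_contra hlt
  rw [not_le, max_lt_iff, hCdeg] at hlt
  have hreg_lt : p.natDegree < C.deg + n := by
    have h1 : ((∑ i, (d i : ℤ) + l - n + 1 : ℤ) : WithBot ℤ) < ((1 + C.deg : ℤ) : WithBot ℤ) :=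
      hlt.2
    rw [WithBot.coe_lt_coe] at h1
    have : (p.natDegree : ℤ) ≤ ∑ i, (d i : ℤ) + l := by exact_mod_cast hpdeg
    omega
  have hPlt : ∀ a ∈ shape P, 0 < a.1 → a.2 < C.deg := by
    intro a ha hpos
    obtain ⟨C', hC', rfl⟩ := mem_shape.1 ha
    have h1 : ((C'.deg : ℤ) : WithBot ℤ) ≤ degree (positiveCones P) :=
      Finset.le_sup (f := fun C : Cone K n e => ((C.deg : ℤ) : WithBot ℤ))
        (Finset.mem_filter.2 ⟨hC', hpos⟩)
    have h2 := (add_le_add_right h1 1).trans_lt hlt.1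
    norm_cast at h2
    simp only
    omega
  exact degree_bound hD hQ.std hT hP.1.std hP.nodup hTs.symm hpP hreg_lt hPlt _
    (mem_shape.2 ⟨C, hC, rfl⟩) rfl
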